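/- Let $\mathcal E$ and $\mathcal I$ be finite sets, $|\mathcal E|=n$, $|\mathcal I|=m$, labelling the external and internal edges of a metric graph; let $a_i>0$ $(i\in\mathcal I)$, and identify $e\in\mathcal E$ with $[0,\infty)$ and $i\in\mathcal I$ with $[0,a_i]$. Let $\mathcal H=\bigoplus_{e\in\mathcal E}L^2(0,\infty)\oplus\bigoplus_{i\in\mathcal I}L^2(0,a_i)$ be the orthogonal sum of complex $L^2$ spaces. Let $\mathcal A=\{\mathcal A_j\}_{j\in\mathcal E\cup\mathcal I}$ be real-valued functions, each continuous and bounded on its closed edge. Let $\Delta_{\mathcal A}^{\max}$ be the operator $(\Delta^{\max}_{\mathcal A}\psi)_j=\left(\frac{d}{dx}-\mathrm i\mathcal A_j\right)^2\psi_j$ in $\mathcal H$, defined on all $\psi\in\mathcal H$ whose first and second distributional magnetic derivatives $\left(\frac{d}{dx}-\mathrm i\mathcal A_j\right)\psi_j$ and $\left(\frac{d}{dx}-\mathrm i\mathcal A_j\right)^2\psi_j$ are square integrable on every edge. Such $\psi$ are $C^1$ up to the ends of the edges; put $$\underline\psi=\begin{pmatrix}\{\psi_e(0)\}_{e\in\mathcal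 E}\\ \{\psi_i(0)\}_{i\in\mathcal I}\\ \{\psi_i(a_i)\}_{i\in\mathcal I}\end{pmatrix},\qquad \underline\psi'=\begin{pmatrix}\{\psi_e'(0)\}_{e\in\mathcal E}\\ \{\psi_i'(0)\}_{i\in\mathcal I}\\ \{-\psi_i'(a_i)\}_{i\in\mathcal I}\end{pmatrix},$$ $$\underline{\mathcal A}=\mathrm{diag}\left(\{\mathcal A_e(0)\}_{e\in\mathcal E},\{\mathcal A_i(0)\}_{i\in\mathcal I},\{-\mathcal A_i(a_i)\}_{i\in\mathcal I}\right).$$ For complex $(n+2m)\times(n+2m)$ matrices $A,B$ let $\Delta(A,B;\mathcal A)$ be the restriction of $\Delta^{\max}_{\mathcal A}$ to those $\psi$ in its domain that satisfy the boundary condition $$A\underline\psi+B\left(\underline\psi'-\mathrm i\,\underline{\mathcal A}\,\underline\psi\right)=0 .$$ Let $\Delta^0_{\mathcal A}$ be the restriction of $\Delta^{\max}_{\mathcal A}$ to those $\psi$ with $\underline\psi=\underline\psi'=0$. A self-adjoint magnetic Laplacian is a self-adjoint operator in $\mathcal H$ that is a restriction of $\Delta^{\max}_{\mathcal A}$ or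 an extension of $\Delta^0_{\mathcal A}$. (1) For all complex $(n+2m)\times(n+2m)$ matrices $A,B$, the operator $\Delta(A,B;\mathcal A)$ is self-adjoint if and only if $AB^\dagger-BA^\dagger=0$ and the $(n+2m)\times 2(n+2m)$ matrix $(A,B)$ has maximal rank $n+2m$. (2) Conversely, every self-adjoint magnetic Laplacian equals $\Delta(A,B;\mathcal A)$ for some complex $(n+2m)\times(n+2m)$ matrices $A,B$ such that $AB^\dagger-BA^\dagger=0$ and $(A,B)$ has rank $n+2m$. -/

import Mathlib

open MeasureTheory Set
open scoped ContDiff Matrix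

noncomputable section

namespace MagneticGraph

/-- The lengths `a i > 0` of the internal edges, labelled by `I`. -/
structure EdgeLengths (I : Type*) where
  len : I → ℝ
  pos : ∀ i, 0 < len i

/-- The closed interval carried by an edge: `[0, ∞)` for an external edge `e ∈ E` and `[0, aᵢ]` for
an internal edge `i ∈ I`. -/
def edge {E I : Type*} (a : EdgeLengths I) : E ⊕ I → Set ℝ
  | Sum.inl _ => Ici 0
  | Sum.inr i => Icc 0 (a.len i)

/-- The open interval carried by an edge: `(0, ∞)` or `(0, aᵢ)`. -/
def openEdge {E I : Type*} (a : EdgeLengths I) : E ⊕ I → Set ℝ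
  | Sum.inl _ => Ioi 0
  | Sum.inr i => Ioo 0 (a.len i)

/-- A real vector potential on the graph, continuous and bounded on every (closed) edge. The values
of `toFun j` outside the edge `j` play no role. -/
structure VectorPotential (E : Type*) {I : Type*} (a : EdgeLengths I) where
  toFun : E ⊕ I → ℝ → ℝ
  continuousOn : ∀ j, ContinuousOn (toFun j) (edge a j)
  bounded : ∃ C : ℝ, ∀ j, ∀ x ∈ edge a j, |toFun j x| ≤ C

/-- Lebesgue measure on an edge. -/
abbrev edgeMeasure {E I : Type*} (a : EdgeLengths I) (j : E ⊕ I) : Measure ℝ :=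
  volume.restrict (openEdge a j)

/-- The Hilbert space of the graph: the orthogonal sum of the spaces `L²(0, ∞)`, one for each
external edge, and `L²(0, aᵢ)`, one for each internal edge. -/
abbrev GraphL2 (E : Type*) {I : Type*} [Fintype E] [Fintype I] (a : EdgeLengths I) : Type _ :=
  PiLp 2 (fun j : E ⊕ I => Lp ℂ 2 (edgeMeasure a j))

/-- `g = (d/dx - i 𝒜ⱼ) f` on the open edge `j` in the sense of distributions, that is
`f' = g + i 𝒜ⱼ f` tested against all smooth functions compactly supported in the open edge. -/
def IsWeakMagneticDeriv {E I : Type*} {a : EdgeLengths I} (𝒜 : VectorPotential E a) (j : E ⊕ I)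
    (f g : ℝ → ℂ) : Prop :=
  ∀ η : ℝ → ℝ, ContDiff ℝ ∞ η → HasCompactSupport η → tsupport η ⊆ openEdge a j →
    ∫ x in openEdge a j, deriv η x • f x =
      - ∫ x in openEdge a j, η x • (g x + Complex.I * (𝒜.toFun j x : ℂ) * f x)

section Basic

variable {E I : Type*} {a : EdgeLengths I}

lemma isOpen_openEdge (j : E ⊕ I) : IsOpen (openEdge a j) := by
  cases j
  · exact isOpen_Ioi
  · exact isOpen_Ioo

lemma openEdge_subset_edge (j : E ⊕ I) : openEdge a j ⊆ edge a j := by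
  cases j
  · exact Ioi_subset_Ici_self
  · exact Ioo_subset_Icc_self

lemma integrable_test_smul {j : E ⊕ I} {η : ℝ → ℝ} (hη : Continuous η) (hc : HasCompactSupport η)
    {f : ℝ → ℂ} (hf : MemLp f 2 (edgeMeasure a j)) :
    Integrable (fun x => η x • f x) (edgeMeasure a j) := by
  have h2 : MemLp η 2 (edgeMeasure a j) :=
    (hη.memLp_of_hasCompactSupport hc (μ := volume)).restrict _
  have h3 : MemLp (fun x => η x • f x) 1 (edgeMeasure a j) := hf.smul h2
  exact memLp_one_iff_integrable.1 h3

lemma memLp_potential_mul (𝒜 : VectorPotential E a) {j : E ⊕ I}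
    {f : ℝ → ℂ} (hf : MemLp f 2 (edgeMeasure a j)) :
    MemLp (fun x => Complex.I * (𝒜.toFun j x : ℂ) * f x) 2 (edgeMeasure a j) := by
  obtain ⟨C, hC⟩ := 𝒜.bounded
  have hm : AEStronglyMeasurable (fun x => Complex.I * (𝒜.toFun j x : ℂ)) (edgeMeasure a j) := by
    refine ContinuousOn.aestronglyMeasurable ?_ (isOpen_openEdge j).measurableSet
    exact continuousOn_const.mul (Complex.continuous_ofReal.comp_continuousOn
      ((𝒜.continuousOn j).mono (openEdge_subset_edge j)))
  refine MemLp.of_le_mul (c := C) hf (hm.mul hf.1) ?_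
  filter_upwards [ae_restrict_mem (isOpen_openEdge j).measurableSet] with x hx
  rw [norm_mul, norm_mul, Complex.norm_I, one_mul, Complex.norm_real, Real.norm_eq_abs]
  exact mul_le_mul_of_nonneg_right (hC j x (openEdge_subset_edge j hx)) (norm_nonneg _)

variable {𝒜 : VectorPotential E a} {j : E ⊕ I} {f g f₁ g₁ : ℝ → ℂ}

lemma IsWeakMagneticDeriv.congr (h : IsWeakMagneticDeriv 𝒜 j f g)
    (hf : f =ᵐ[edgeMeasure a j] f₁) (hg : g =ᵐ[edgeMeasure a j] g₁) :
    IsWeakMagneticDeriv 𝒜 j f₁ g₁ := by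
  intro η h1 h2 h3
  have e1 : ∫ x in openEdge a j, deriv η x • f₁ x = ∫ x in openEdge a j, deriv η x • f x :=
    integral_congr_ae (by filter_upwards [hf] with x hx; rw [hx])
  have e2 : ∫ x in openEdge a j, η x • (g₁ x + Complex.I * (𝒜.toFun j x : ℂ) * f₁ x) =
      ∫ x in openEdge a j, η x • (g x + Complex.I * (𝒜.toFun j x : ℂ) * f x) :=
    integral_congr_ae (by filter_upwards [hf, hg] with x hx hy; rw [hx, hy])
  rw [e1, e2]
  exact h η h1 h2 h3

lemma IsWeakMagneticDeriv.add (h : IsWeakMagneticDeriv 𝒜 j f g)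
    (h₁ : IsWeakMagneticDeriv 𝒜 j f₁ g₁)
    (hf : MemLp f 2 (edgeMeasure a j)) (hg : MemLp g 2 (edgeMeasure a j))
    (hf₁ : MemLp f₁ 2 (edgeMeasure a j)) (hg₁ : MemLp g₁ 2 (edgeMeasure a j)) :
    IsWeakMagneticDeriv 𝒜 j (f + f₁) (g + g₁) := by
  intro η h1 h2 h3
  have hd : Continuous (deriv η) := h1.continuous_deriv (by simp)
  have hA := hg.add (memLp_potential_mul 𝒜 hf)
  have hA₁ := hg₁.add (memLp_potential_mul 𝒜 hf₁)
  have e := h η h1 h2 h3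
  have e₁ := h₁ η h1 h2 h3
  have i1 := integral_add (integrable_test_smul hd h2.deriv hf)
    (integrable_test_smul hd h2.deriv hf₁)
  have i2 := integral_add (integrable_test_smul h1.continuous h2 hA)
    (integrable_test_smul h1.continuous h2 hA₁)
  simp only [Pi.add_apply] at i1 i2 ⊢
  simp only [smul_add, mul_add] at i1 i2 e e₁ ⊢
  rw [i1, e, e₁, ← neg_add, ← i2]
  congr 2
  ext x
  ring

lemma IsWeakMagneticDeriv.const_smul (c : ℂ) (h : IsWeakMagneticDeriv 𝒜 j f g) :
    IsWeakMagneticDeriv 𝒜 j (c • f) (c • g) := by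
  intro η h1 h2 h3
  have e := h η h1 h2 h3
  have e1 : ∫ x in openEdge a j, deriv η x • (c • f) x =
      c • ∫ x in openEdge a j, deriv η x • f x := by
    rw [← integral_smul]
    congr 1; ext x
    simp only [Pi.smul_apply]
    rw [smul_comm]
  have e2 : ∫ x in openEdge a j, η x • ((c • g) x + Complex.I * (𝒜.toFun j x : ℂ) * (c • f) x) =
      c • ∫ x in openEdge a j, η x • (g x + Complex.I * (𝒜.toFun j x : ℂ) * f x) := by
    rw [← integral_smul]
    congr 1; ext x
    simp only [Pi.smul_apply, smul_eq_mul, Complex.real_smul]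
    ring
  rw [e1, e2, e, smul_neg]

lemma IsWeakMagneticDeriv.zero_zero : IsWeakMagneticDeriv 𝒜 j 0 0 := by
  intro η _ _ _
  simp

/-- The weak magnetic derivative is unique: that of the zero function vanishes. -/
lemma IsWeakMagneticDeriv.eq_zero (h : IsWeakMagneticDeriv 𝒜 j 0 g)
    (hg : MemLp g 2 (edgeMeasure a j)) : g =ᵐ[edgeMeasure a j] 0 := by
  have hloc : LocallyIntegrableOn g (openEdge a j) := by
    have : LocallyIntegrable g (edgeMeasure a j) := hg.locallyIntegrable (by norm_num)
    intro x hx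
    obtain ⟨u, hu, hi⟩ := this x
    refine ⟨u ∩ openEdge a j, Filter.inter_mem (mem_nhdsWithin_of_mem_nhds hu)
      self_mem_nhdsWithin, ?_⟩
    rwa [IntegrableOn, Measure.restrict_restrict' (isOpen_openEdge j).measurableSet] at hi
  have := (isOpen_openEdge j).ae_eq_zero_of_integral_contDiff_smul_eq_zero hloc (by
    intro η h1 h2 h3
    have e := h η h1 h2 h3
    simp only [Pi.zero_apply, smul_zero, mul_zero, add_zero, integral_zero] at e
    rw [eq_comm, neg_eq_zero] at e
    rw [← e]
    refine (setIntegral_eq_integral_of_forall_compl_eq_zero fun x hx => ?_).symm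
    rw [image_eq_zero_of_notMem_tsupport (fun hx' => hx (h3 hx')), zero_smul])
  rw [Filter.EventuallyEq, ae_restrict_iff' (isOpen_openEdge j).measurableSet]
  exact this

end Basic

section Operators

variable {E I : Type*} [Fintype E] [Fintype I] {a : EdgeLengths I}

/-- The graph of the maximal operator `(d/dx - i 𝒜)²`: pairs `(ψ, φ)` of elements of the Hilbert
space such that the first distributional magnetic derivative `χ` of `ψ` is square integrable and
the magnetic derivative of `χ` is the square integrable function `φ`. -/
def maximalGraph (𝒜 : VectorPotential E a) : Submodule ℂ (GraphL2 E a × GraphL2 E a) where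
  carrier := {p | ∃ χ : GraphL2 E a, ∀ j,
    IsWeakMagneticDeriv 𝒜 j (p.1 j) (χ j) ∧ IsWeakMagneticDeriv 𝒜 j (χ j) (p.2 j)}
  zero_mem' := ⟨0, fun j => ⟨IsWeakMagneticDeriv.zero_zero.congr
      (Lp.coeFn_zero _ _ _).symm (Lp.coeFn_zero _ _ _).symm, IsWeakMagneticDeriv.zero_zero.congr
      (Lp.coeFn_zero _ _ _).symm (Lp.coeFn_zero _ _ _).symm⟩⟩
  add_mem' := by
    rintro p q ⟨χ, hp⟩ ⟨χ', hq⟩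
    refine ⟨χ + χ', fun j => ⟨?_, ?_⟩⟩
    · exact ((hp j).1.add (hq j).1 (Lp.memLp _) (Lp.memLp _) (Lp.memLp _) (Lp.memLp _)).congr
        (Lp.coeFn_add _ _).symm (Lp.coeFn_add _ _).symm
    · exact ((hp j).2.add (hq j).2 (Lp.memLp _) (Lp.memLp _) (Lp.memLp _) (Lp.memLp _)).congr
        (Lp.coeFn_add _ _).symm (Lp.coeFn_add _ _).symm
  smul_mem' := by
    rintro c p ⟨χ, hp⟩
    refine ⟨c • χ, fun j => ⟨?_, ?_⟩⟩
    · exact ((hp j).1.const_smul c).congr (Lp.coeFn_smul _ _).symm (Lp.coeFn_smul _ _).symm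
    · exact ((hp j).2.const_smul c).congr (Lp.coeFn_smul _ _).symm (Lp.coeFn_smul _ _).symm

/-- The maximal graph is the graph of a function. -/
lemma maximalGraph_functional (𝒜 : VectorPotential E a) :
    ∀ p ∈ maximalGraph 𝒜, p.1 = 0 → p.2 = 0 := by
  rintro ⟨ψ, φ⟩ ⟨χ, h⟩ (rfl : ψ = 0)
  ext1 j
  have h1 := ((h j).1.congr (Lp.coeFn_zero _ _ _) (Filter.EventuallyEq.refl _ _)).eq_zero
    (Lp.memLp _)
  have h2 := ((h j).2.congr h1 (Filter.EventuallyEq.refl _ _)).eq_zero (Lp.memLp _)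
  exact (Lp.eq_zero_iff_ae_eq_zero).2 h2

/-- The maximal operator `(d/dx - i 𝒜)²` in the Hilbert space of the graph, on the magnetic Sobolev
space of all square integrable functions whose first and second distributional magnetic
derivatives are square integrable. -/
def maximalOperator (𝒜 : VectorPotential E a) : GraphL2 E a →ₗ.[ℂ] GraphL2 E a :=
  (maximalGraph 𝒜).toLinearPMap

lemma maximalOperator_graph (𝒜 : VectorPotential E a) :
    (maximalOperator 𝒜).graph = maximalGraph 𝒜 :=
  Submodule.toLinearPMap_graph_eq _ (maximalGraph_functional 𝒜)

end Operators

section Boundary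

variable {E I : Type*}

/-- The labels of the `n + 2m` ends of edges: initial ends of the external edges, initial ends of
the internal edges, terminal ends of the internal edges. -/
abbrev Ends (E I : Type*) : Type _ := E ⊕ (I ⊕ I)

/-- The vector `({fₑ(0)}, {fᵢ(0)}, {fᵢ(aᵢ)})`. -/
def boundaryValue (a : EdgeLengths I) (f : E ⊕ I → ℝ → ℂ) : Ends E I → ℂ
  | Sum.inl e => f (Sum.inl e) 0
  | Sum.inr (Sum.inl i) => f (Sum.inr i) 0
  | Sum.inr (Sum.inr i) => f (Sum.inr i) (a.len i)

/-- The vector `({fₑ'(0)}, {fᵢ'(0)}, {-fᵢ'(aᵢ)})` of one-sided inward derivatives. -/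
def boundaryDeriv (a : EdgeLengths I) (f : E ⊕ I → ℝ → ℂ) : Ends E I → ℂ
  | Sum.inl e => derivWithin (f (Sum.inl e)) (edge a (Sum.inl e)) 0
  | Sum.inr (Sum.inl i) => derivWithin (f (Sum.inr i)) (edge a (Sum.inr i : E ⊕ I)) 0
  | Sum.inr (Sum.inr i) => - derivWithin (f (Sum.inr i)) (edge a (Sum.inr i : E ⊕ I)) (a.len i)

/-- The diagonal entries `({𝒜ₑ(0)}, {𝒜ᵢ(0)}, {-𝒜ᵢ(aᵢ)})`. -/
def boundaryPotential {a : EdgeLengths I} (𝒜 : VectorPotential E a) : Ends E I → ℂ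
  | Sum.inl e => (𝒜.toFun (Sum.inl e) 0 : ℂ)
  | Sum.inr (Sum.inl i) => (𝒜.toFun (Sum.inr i) 0 : ℂ)
  | Sum.inr (Sum.inr i) => -(𝒜.toFun (Sum.inr i) (a.len i) : ℂ)

/-- The vector `ψ' - i 𝒜 ψ` of magnetic boundary derivatives, with `𝒜` the diagonal matrix of
boundary values of the potential. -/
def boundaryMagneticDeriv [Fintype E] [Fintype I] [DecidableEq E] [DecidableEq I]
    {a : EdgeLengths I} (𝒜 : VectorPotential E a) (f : E ⊕ I → ℝ → ℂ) : Ends E I → ℂ :=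
  boundaryDeriv a f - Complex.I • (Matrix.diagonal (boundaryPotential 𝒜) *ᵥ boundaryValue a f)

/-- `f` is a representative of `ψ` which is continuously differentiable up to the ends of every
edge. -/
def IsC1Representative [Fintype E] [Fintype I] {a : EdgeLengths I} (ψ : GraphL2 E a)
    (f : E ⊕ I → ℝ → ℂ) : Prop :=
  ∀ j, ContDiffOn ℝ 1 (f j) (edge a j) ∧ f j =ᵐ[edgeMeasure a j] ψ j

lemma IsC1Representative.differentiableWithinAt [Fintype E] [Fintype I] {a : EdgeLengths I}
    {ψ : GraphL2 E a} {f : E ⊕ I → ℝ → ℂ} (h : IsC1Representative ψ f) (j : E ⊕ I) {x : ℝ}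
    (hx : x ∈ edge a j) : DifferentiableWithinAt ℝ (f j) (edge a j) x :=
  (h j).1.differentiableOn (by simp) x hx

lemma IsC1Representative.add [Fintype E] [Fintype I] {a : EdgeLengths I}
    {ψ φ : GraphL2 E a} {f g : E ⊕ I → ℝ → ℂ} (hf : IsC1Representative ψ f)
    (hg : IsC1Representative φ g) : IsC1Representative (ψ + φ) (f + g) := fun j =>
  ⟨(hf j).1.add (hg j).1, ((hf j).2.add (hg j).2).trans (Lp.coeFn_add _ _).symm⟩

lemma IsC1Representative.const_smul [Fintype E] [Fintype I] {a : EdgeLengths I} (c : ℂ)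
    {ψ : GraphL2 E a} {f : E ⊕ I → ℝ → ℂ} (hf : IsC1Representative ψ f) :
    IsC1Representative (c • ψ) (c • f) := fun j =>
  ⟨(hf j).1.const_smul c, ((hf j).2.const_smul c).trans (Lp.coeFn_smul _ _).symm⟩

lemma zero_mem_edge (a : EdgeLengths I) (j : E ⊕ I) : (0 : ℝ) ∈ edge a j := by
  cases j with
  | inl e => exact self_mem_Ici
  | inr i => exact left_mem_Icc.2 (a.pos i).le

lemma len_mem_edge (a : EdgeLengths I) (i : I) : a.len i ∈ edge a (Sum.inr i : E ⊕ I) :=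
  right_mem_Icc.2 (a.pos i).le

lemma boundaryValue_add (a : EdgeLengths I) (f g : E ⊕ I → ℝ → ℂ) :
    boundaryValue a (f + g) = boundaryValue a f + boundaryValue a g := by
  ext (e | i | i) <;> rfl

lemma boundaryValue_smul (a : EdgeLengths I) (c : ℂ) (f : E ⊕ I → ℝ → ℂ) :
    boundaryValue a (c • f) = c • boundaryValue a f := by
  ext (e | i | i) <;> rfl

lemma boundaryDeriv_add [Fintype E] [Fintype I] {a : EdgeLengths I}
    {ψ φ : GraphL2 E a} {f g : E ⊕ I → ℝ → ℂ} (hf : IsC1Representative ψ f)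
    (hg : IsC1Representative φ g) :
    boundaryDeriv a (f + g) = boundaryDeriv a f + boundaryDeriv a g := by
  have key : ∀ (j : E ⊕ I) (x : ℝ), x ∈ edge a j → derivWithin ((f + g) j) (edge a j) x =
      derivWithin (f j) (edge a j) x + derivWithin (g j) (edge a j) x := fun j x hx =>
    derivWithin_add (hf.differentiableWithinAt j hx) (hg.differentiableWithinAt j hx)
  ext (e | i | i)
  · exact key _ _ (zero_mem_edge a _)
  · exact key _ _ (zero_mem_edge a _)
  · simp only [boundaryDeriv, Pi.add_apply]
    rw [← neg_add, ← key _ _ (len_mem_edge a i)]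
    rfl

lemma boundaryDeriv_smul (a : EdgeLengths I) (c : ℂ) (f : E ⊕ I → ℝ → ℂ) :
    boundaryDeriv a (c • f) = c • boundaryDeriv a f := by
  have key : ∀ (j : E ⊕ I) (x : ℝ), derivWithin ((c • f) j) (edge a j) x =
      c • derivWithin (f j) (edge a j) x := fun j x => derivWithin_const_smul_field c (f j)
  ext (e | i | i)
  · exact key _ _
  · exact key _ _
  · simp only [boundaryDeriv, Pi.smul_apply]
    rw [smul_neg, ← key]
    rfl

end Boundary

section Laplacian

variable {E I : Type*} [Fintype E] [Fintype I] [DecidableEq E] [DecidableEq I] {a : EdgeLengths I}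

/-- The functions on the graph that satisfy the boundary condition `A ψ + B (ψ' - i 𝒜 ψ) = 0`. -/
def boundaryCondition (𝒜 : VectorPotential E a) (A B : Matrix (Ends E I) (Ends E I) ℂ) :
    Submodule ℂ (GraphL2 E a) where
  carrier := {ψ | ∃ f : E ⊕ I → ℝ → ℂ, IsC1Representative ψ f ∧
    A *ᵥ boundaryValue a f + B *ᵥ boundaryMagneticDeriv 𝒜 f = 0}
  zero_mem' := by
    refine ⟨0, fun j => ⟨contDiffOn_const, (Lp.coeFn_zero _ _ _).symm⟩, ?_⟩
    have h0 : boundaryValue a (0 : E ⊕ I → ℝ → ℂ) = 0 := by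
      simpa using boundaryValue_smul a (0 : ℂ) (0 : E ⊕ I → ℝ → ℂ)
    have h1 : boundaryDeriv a (0 : E ⊕ I → ℝ → ℂ) = 0 := by
      simpa using boundaryDeriv_smul a (0 : ℂ) (0 : E ⊕ I → ℝ → ℂ)
    simp [boundaryMagneticDeriv, h0, h1]
  add_mem' := by
    rintro ψ φ ⟨f, hf, hf'⟩ ⟨g, hg, hg'⟩
    refine ⟨f + g, hf.add hg, ?_⟩
    have : A *ᵥ boundaryValue a (f + g) + B *ᵥ boundaryMagneticDeriv 𝒜 (f + g) =
        (A *ᵥ boundaryValue a f + B *ᵥ boundaryMagneticDeriv 𝒜 f) +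
        (A *ᵥ boundaryValue a g + B *ᵥ boundaryMagneticDeriv 𝒜 g) := by
      simp only [boundaryMagneticDeriv, boundaryValue_add, boundaryDeriv_add hf hg,
        Matrix.mulVec_add, Matrix.mulVec_sub, smul_add]
      abel
    rw [this, hf', hg', add_zero]
  smul_mem' := by
    rintro c ψ ⟨f, hf, hf'⟩
    refine ⟨c • f, hf.const_smul c, ?_⟩
    have : A *ᵥ boundaryValue a (c • f) + B *ᵥ boundaryMagneticDeriv 𝒜 (c • f) =
        c • (A *ᵥ boundaryValue a f + B *ᵥ boundaryMagneticDeriv 𝒜 f) := by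
      simp only [boundaryMagneticDeriv, boundaryValue_smul, boundaryDeriv_smul,
        Matrix.mulVec_sub, Matrix.mulVec_smul, smul_add, smul_sub]
      rw [smul_comm c Complex.I]
    rw [this, hf', smul_zero]

/-- The magnetic Laplacian `Δ(A, B; 𝒜)`: the operator `(d/dx - i 𝒜)²` on all functions in the
magnetic Sobolev space that satisfy `A ψ + B (ψ' - i 𝒜 ψ) = 0`. -/
def magneticLaplacian (𝒜 : VectorPotential E a) (A B : Matrix (Ends E I) (Ends E I) ℂ) :
    GraphL2 E a →ₗ.[ℂ] GraphL2 E a :=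
  (maximalOperator 𝒜).domRestrict (boundaryCondition 𝒜 A B)

/-- The functions on the graph that vanish at the ends of all edges together with their first
derivatives. -/
def vanishingBoundary (E : Type*) {I : Type*} [Fintype E] [Fintype I] (a : EdgeLengths I) :
    Submodule ℂ (GraphL2 E a) where
  carrier := {ψ | ∃ f : E ⊕ I → ℝ → ℂ, IsC1Representative ψ f ∧
    boundaryValue a f = 0 ∧ boundaryDeriv a f = 0}
  zero_mem' := by
    refine ⟨0, fun j => ⟨contDiffOn_const, (Lp.coeFn_zero _ _ _).symm⟩, ?_, ?_⟩
    · simpa using boundaryValue_smul a (0 : ℂ) (0 : E ⊕ I → ℝ → ℂ)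
    · simpa using boundaryDeriv_smul a (0 : ℂ) (0 : E ⊕ I → ℝ → ℂ)
  add_mem' := by
    rintro ψ φ ⟨f, hf, hf', hf''⟩ ⟨g, hg, hg', hg''⟩
    refine ⟨f + g, hf.add hg, ?_, ?_⟩
    · rw [boundaryValue_add, hf', hg', add_zero]
    · rw [boundaryDeriv_add hf hg, hf'', hg'', add_zero]
  smul_mem' := by
    rintro c ψ ⟨f, hf, hf', hf''⟩
    refine ⟨c • f, hf.const_smul c, ?_, ?_⟩
    · rw [boundaryValue_smul, hf', smul_zero]
    · rw [boundaryDeriv_smul, hf'', smul_zero]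

/-- The minimal operator `Δ⁰`: the operator `(d/dx - i 𝒜)²` on the functions in the magnetic
Sobolev space that vanish at the vertices together with their first derivatives. -/
def minimalOperator (𝒜 : VectorPotential E a) : GraphL2 E a →ₗ.[ℂ] GraphL2 E a :=
  (maximalOperator 𝒜).domRestrict (vanishingBoundary E a)

/-- `T` is a self-adjoint magnetic Laplacian with vector potential `𝒜`: it is self-adjoint
(in particular densely defined), and it acts as the differential expression `(d/dx - i 𝒜)²`, in
the sense that it is a restriction of the maximal operator or an extension of the minimal one. -/
def IsSelfAdjointMagneticLaplacian (𝒜 : VectorPotential E a)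
    (T : GraphL2 E a →ₗ.[ℂ] GraphL2 E a) : Prop :=
  IsSelfAdjoint T ∧ (T ≤ maximalOperator 𝒜 ∨ minimalOperator 𝒜 ≤ T)

end Laplacian

end MagneticGraph

end

/-!
The proof computes the adjoints of all operators between the minimal operator `Δ⁰` and the maximal
operator `Δ` in terms of boundary data. For a function `ψ` in the maximal domain, let
`boundaryMap ψ = (x, y)` consist of the boundary values and the inward magnetic derivatives. Three
facts make this map a boundary triple.

* Green's identity `inner_sub_inner_eq`: `⟨Δψ, φ⟩ - ⟨ψ, Δφ⟩` is the Hermitian symplectic form of the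
  boundary data of `ψ` and `φ`. Functions in the maximal domain are absolutely continuous together
  with their magnetic derivatives (by the lemma of du Bois-Reymond), so that one may integrate by
  parts; the potential is real and drops out, and there is no contribution from infinity, because
  an integrable function that has a limit at infinity tends to zero.
* `boundaryMap_surjective`: all boundary data occur.
* `adjoint_restrictedGraph_bot_le`: the adjoint of `Δ⁰` is contained in `Δ`. Multiplication by the
  phase factors `exp (i ∫ 𝒜)` turns derivatives into magnetic derivatives, hence maps test functions
  into the domain of `Δ⁰` although the potential is merely continuous. A function in the domain of
  the adjoint therefore has, after the inverse gauge transformation, a square integrable second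
  distributional derivative, and then its first derivative is square integrable as well.

It follows that the adjoint of the restriction of `Δ` to the boundary data in a subspace `M` is the
restriction to the symplectic complement of `M` (`adjoint_restrictedGraph`), so that self-adjoint
extensions of `Δ⁰` correspond to Lagrangian subspaces. The rest is linear algebra: the complement of
the kernel of `(A, B)` is the range of `(-Bᴴ, Aᴴ)`, so that the kernel is Lagrangian if and only if
`A Bᴴ = B Aᴴ` and `(A, B)` has full rank, and every Lagrangian subspace is such a kernel.
-/

namespace MagneticGraph

/-! ### Primitives of integrable functions -/

/-- `F` is a primitive of the integrable function `f` on `[0, b]`; equivalently, `F` is absolutely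
continuous there, with derivative `f` almost everywhere. -/
structure IsPrimitive (F f : ℝ → ℂ) (b : ℝ) : Prop where
  nonneg : 0 ≤ b
  integrable : IntervalIntegrable f volume 0 b
  eq : ∀ x ∈ Icc 0 b, F x = F 0 + ∫ t in (0 : ℝ)..x, f t

namespace IsPrimitive

variable {F G f g : ℝ → ℂ} {b : ℝ}

lemma integrable_of_mem (hF : IsPrimitive F f b) {x : ℝ} (hx : x ∈ Icc 0 b) :
    IntervalIntegrable f volume 0 x :=
  hF.integrable.mono_set (uIcc_subset_uIcc_left (by rwa [uIcc_of_le hF.nonneg]))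

lemma congr (hF : IsPrimitive F f b) (hFG : EqOn F G (Icc 0 b))
    (hfg : ∀ᵐ t, t ∈ Ioo 0 b → f t = g t) : IsPrimitive G g b := by
  have hae : ∀ x ∈ Icc 0 b, ∀ᵐ t, t ∈ uIoc 0 x → f t = g t := by
    intro x hx
    have hb : ∀ᵐ t : ℝ, t ≠ b := by simp [ae_iff]
    filter_upwards [hfg, hb] with t ht htb h
    rw [uIoc_of_le hx.1] at h
    exact ht ⟨h.1, lt_of_le_of_ne (h.2.trans hx.2) htb⟩
  refine ⟨hF.nonneg, hF.integrable.congr_ae ?_, fun x hx => ?_⟩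
  · exact (ae_restrict_iff' measurableSet_uIoc).2 (hae b ⟨hF.nonneg, le_rfl⟩)
  · rw [← hFG hx, ← hFG ⟨le_rfl, hF.nonneg⟩, hF.eq x hx,
      intervalIntegral.integral_congr_ae (hae x hx)]

lemma of_intervalIntegrable (hb : 0 ≤ b) (hf : IntervalIntegrable f volume 0 b) (c : ℂ) :
    IsPrimitive (fun x => c + ∫ t in (0 : ℝ)..x, f t) f b :=
  ⟨hb, hf, fun x _ => by simp⟩

lemma of_hasDerivAt (hb : 0 ≤ b) (h : ∀ x, HasDerivAt F (f x) x) (hf : Continuous f) :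
    IsPrimitive F f b :=
  ⟨hb, hf.intervalIntegrable _ _, fun x _ => by
    rw [intervalIntegral.integral_eq_sub_of_hasDerivAt (fun y _ => h y)
      (hf.intervalIntegrable _ _)]
    ring⟩

lemma add (hF : IsPrimitive F f b) (hG : IsPrimitive G g b) :
    IsPrimitive (fun x => F x + G x) (fun x => f x + g x) b :=
  ⟨hF.nonneg, hF.integrable.add hG.integrable, fun x hx => by
    rw [intervalIntegral.integral_add (hF.integrable_of_mem hx) (hG.integrable_of_mem hx),
      hF.eq x hx, hG.eq x hx]
    ring⟩

lemma neg (hF : IsPrimitive F f b) : IsPrimitive (fun x => -F x) (fun x => -f x) b :=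
  ⟨hF.nonneg, hF.integrable.neg, fun x hx => by
    rw [intervalIntegral.integral_neg, hF.eq x hx]; ring⟩

lemma conj (hF : IsPrimitive F f b) :
    IsPrimitive (fun x => starRingEnd ℂ (F x)) (fun x => starRingEnd ℂ (f x)) b := by
  refine ⟨hF.nonneg, ?_, fun x hx => ?_⟩
  · have h := hF.integrable
    rw [intervalIntegrable_iff] at h ⊢
    exact (Complex.conjCLE.toContinuousLinearMap.integrable_comp h)
  · rw [hF.eq x hx, map_add, intervalIntegral.integral_of_le hx.1,
      intervalIntegral.integral_of_le hx.1, integral_conj]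

/-- The primitive as an absolutely continuous function on the whole line. -/
lemma exists_absolutelyContinuous (hF : IsPrimitive F f b) :
    ∃ F' : ℝ → ℂ, EqOn F F' (Icc 0 b) ∧ AbsolutelyContinuousOnInterval F' 0 b ∧
      ∀ᵐ x, x ∈ uIcc 0 b → HasDerivAt F' (f x) x := by
  have hre : IntervalIntegrable (fun t => (f t).re) volume 0 b := by
    have h := hF.integrable
    rw [intervalIntegrable_iff] at h ⊢
    exact h.re
  have him : IntervalIntegrable (fun t => (f t).im) volume 0 b := by
    have h := hF.integrable
    rw [intervalIntegrable_iff] at h ⊢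
    exact h.im
  have hc : ∀ c : ℂ, AbsolutelyContinuousOnInterval (fun _ : ℝ => c) 0 b := fun c =>
    ContDiffOn.absolutelyContinuousOnInterval contDiffOn_const
  have h1 : AbsolutelyContinuousOnInterval (fun x => ∫ t in (0 : ℝ)..x, (f t).re) 0 b :=
    hre.absolutelyContinuousOnInterval_intervalIntegral left_mem_uIcc
  have h2 : AbsolutelyContinuousOnInterval (fun x => ∫ t in (0 : ℝ)..x, (f t).im) 0 b :=
    him.absolutelyContinuousOnInterval_intervalIntegral left_mem_uIcc
  refine ⟨fun x => F 0 + ((∫ t in (0 : ℝ)..x, (f t).re) • (1 : ℂ) +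
    (∫ t in (0 : ℝ)..x, (f t).im) • Complex.I), fun x hx => ?_, ?_, ?_⟩
  · have hi := hF.integrable_of_mem hx
    rw [intervalIntegrable_iff_integrableOn_Ioc_of_le hx.1] at hi
    have e := integral_re_add_im hi
    simp only [RCLike.re_eq_complex_re, RCLike.im_eq_complex_im, RCLike.I_to_complex,
      Complex.coe_algebraMap] at e
    simp only [intervalIntegral.integral_of_le hx.1, Complex.real_smul, mul_one]
    rw [hF.eq x hx, intervalIntegral.integral_of_le hx.1]
    exact congrArg _ e.symm
  · exact (hc _).fun_add ((h1.fun_smul (hc 1)).fun_add (h2.fun_smul (hc Complex.I)))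
  · filter_upwards [hre.ae_hasDerivAt_integral, him.ae_hasDerivAt_integral] with x hx hx' hxb
    have d := (((hx hxb 0 left_mem_uIcc).smul_const (1 : ℂ)).add
      ((hx' hxb 0 left_mem_uIcc).smul_const Complex.I)).const_add (F 0)
    convert! d using 1
    simp

lemma continuousOn (hF : IsPrimitive F f b) : ContinuousOn F (Icc 0 b) := by
  obtain ⟨F', h, hac, -⟩ := hF.exists_absolutelyContinuous
  rw [← uIcc_of_le hF.nonneg] at h ⊢
  exact hac.continuousOn.congr h

/-- The product rule for primitives, that is, integration by parts. -/
lemma mul (hF : IsPrimitive F f b) (hG : IsPrimitive G g b) :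
    IsPrimitive (fun x => F x * G x) (fun x => f x * G x + F x * g x) b := by
  obtain ⟨F', hFF, hFac, hFd⟩ := hF.exists_absolutelyContinuous
  obtain ⟨G', hGG, hGac, hGd⟩ := hG.exists_absolutelyContinuous
  have hint : IntervalIntegrable (fun x => f x * G' x + F' x * g x) volume 0 b :=
    (hF.integrable.mul_continuousOn hGac.continuousOn).add
      (hG.integrable.continuousOn_mul hFac.continuousOn)
  have key : IsPrimitive (fun x => F' x * G' x) (fun x => f x * G' x + F' x * g x) b := by
    refine ⟨hF.nonneg, hint, fun x hx => ?_⟩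
    obtain ⟨H', hHH, hHac, hHd⟩ :=
      (of_intervalIntegrable hF.nonneg hint 0).exists_absolutelyContinuous
    have hac : AbsolutelyContinuousOnInterval (fun x => F' x * G' x - H' x) 0 b := by
      have h1 : AbsolutelyContinuousOnInterval (fun x => F' x * G' x) 0 b := hFac.fun_smul hGac
      exact h1.fun_sub hHac
    obtain ⟨C, hC⟩ := hac.const_of_ae_hasDerivAt_zero (by
      filter_upwards [hFd, hGd, hHd] with y h1 h2 h3 hy
      convert! ((h1 hy).mul (h2 hy)).sub (h3 hy) using 1
      ring)
    have h0 := hC 0 left_mem_uIcc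
    have hx' := hC x (by rwa [uIcc_of_le hF.nonneg])
    have e0 := hHH ⟨le_rfl, hF.nonneg⟩
    have e1 := hHH hx
    simp only [intervalIntegral.integral_same, zero_add] at e0 e1
    rw [← e0, sub_zero] at h0
    rw [e1, h0, ← hx']
    ring
  refine key.congr (fun x hx => ?_) (Filter.Eventually.of_forall fun t ht => ?_)
  · simp only [hFF hx, hGG hx]
  · simp only [hFF (Ioo_subset_Icc_self ht), hGG (Ioo_subset_Icc_self ht)]

end IsPrimitive

/-- The fundamental theorem of calculus on the half-line: if `w` and its derivative `w'` are both
integrable, then `w` vanishes at infinity. -/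
lemma integral_Ioi_of_isPrimitive {w w' : ℝ → ℂ} (h : ∀ b, 0 ≤ b → IsPrimitive w w' b)
    (hw : IntegrableOn w (Ioi 0)) (hw' : IntegrableOn w' (Ioi 0)) :
    ∫ x in Ioi 0, w' x = - w 0 := by
  have hlim : Filter.Tendsto w Filter.atTop (nhds (w 0 + ∫ x in Ioi 0, w' x)) := by
    refine ((intervalIntegral_tendsto_integral_Ioi 0 hw' Filter.tendsto_id).const_add
      (w 0)).congr' ?_
    filter_upwards [Filter.eventually_ge_atTop 0] with x hx
    exact ((h x hx).eq x ⟨hx, le_rfl⟩).symm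
  have h0 : w 0 + ∫ x in Ioi 0, w' x = 0 := by
    -- Otherwise `‖w‖` is eventually bounded below by a positive constant, hence not integrable.
    by_contra hne
    have hc : 0 < ‖w 0 + ∫ x in Ioi 0, w' x‖ / 2 := by positivity
    obtain ⟨R, hR⟩ := Filter.eventually_atTop.1
      (hlim.norm.eventually (lt_mem_nhds (half_lt_self (norm_pos_iff.2 hne))))
    have hi : IntegrableOn (fun _ : ℝ => ‖w 0 + ∫ x in Ioi 0, w' x‖ / 2) (Ioi (max R 0)) := by
      refine Integrable.mono (hw.mono_set (Ioi_subset_Ioi (le_max_right _ _)))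
        aestronglyMeasurable_const ?_
      filter_upwards [ae_restrict_mem measurableSet_Ioi] with x hx
      rw [Real.norm_of_nonneg hc.le]
      exact (hR x ((le_max_left _ _).trans (le_of_lt hx))).le
    rw [integrableOn_const_iff] at hi
    simp [hc.ne'] at hi
  exact (neg_eq_of_add_eq_zero_right h0).symm

/-- A function on the half-line that is square integrable together with its second derivative has
a square integrable first derivative. -/
lemma integrableOn_norm_sq_of_second_deriv {p p₁ q : ℝ → ℂ}
    (h : ∀ b, 0 ≤ b → IsPrimitive p p₁ b) (h₁ : ∀ b, 0 ≤ b → IsPrimitive p₁ q b)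
    (hp : MemLp p 2 (volume.restrict (Ioi 0))) (hq : MemLp q 2 (volume.restrict (Ioi 0))) :
    IntegrableOn (fun x => ‖p₁ x‖ ^ 2) (Ioi 0) := by
  by_contra hn
  have hc : ∀ b, 0 ≤ b → ContinuousOn p₁ (Icc 0 b) := fun b hb => (h₁ b hb).continuousOn
  have hloc : ∀ b : ℝ, IntegrableOn (fun x => ‖p₁ x‖ ^ 2) (Ioc 0 b) := fun b => by
    rcases le_total 0 b with hb | hb
    · exact (((hc b hb).norm.pow 2).integrableOn_Icc).mono_set Ioc_subset_Icc_self
    · rw [Ioc_eq_empty (not_lt.2 hb)]; exact integrableOn_empty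
  have hpq : IntegrableOn (fun x => starRingEnd ℂ (p x) * q x) (Ioi 0) := by
    have := hq.smul (p := 2) (q := 2) (r := 1) hp.star
    exact memLp_one_iff_integrable.1 this
  have hv : ∀ b, 0 ≤ b → IsPrimitive (fun x => starRingEnd ℂ (p x) * p₁ x)
      (fun x => starRingEnd ℂ (p₁ x) * p₁ x + starRingEnd ℂ (p x) * q x) b :=
    fun b hb => (h b hb).conj.mul (h₁ b hb)
  have hw : ∀ b, 0 ≤ b → IsPrimitive (fun x => starRingEnd ℂ (p x) * p x)
      (fun x => starRingEnd ℂ (p₁ x) * p x + starRingEnd ℂ (p x) * p₁ x) b :=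
    fun b hb => (h b hb).conj.mul (h b hb)
  -- By parts, `conj p * p₁` at `x` is the integral of `‖p₁‖ ^ 2` over `[0, x]`, which is unbounded,
  -- up to an error of size `C`; so its real part is eventually at least `1`.
  set C : ℝ := ‖p 0‖ * ‖p₁ 0‖ + ∫ x in Ioi 0, ‖starRingEnd ℂ (p x) * q x‖ with hC
  have hex : ∃ R, 0 ≤ R ∧ C + 1 < ∫ x in (0 : ℝ)..R, ‖p₁ x‖ ^ 2 := by
    by_contra! hcon
    refine hn (integrableOn_Ioi_of_intervalIntegral_norm_bounded (C + 1) 0 hloc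
      Filter.tendsto_id ?_)
    filter_upwards [Filter.eventually_ge_atTop 0] with R hR
    simpa using hcon R hR
  obtain ⟨R, hR0, hR⟩ := hex
  have hre : ∀ x, R ≤ x → 1 ≤ (starRingEnd ℂ (p x) * p₁ x).re := by
    intro x hx
    have hx0 : 0 ≤ x := hR0.trans hx
    have hi1 : IntervalIntegrable (fun t => starRingEnd ℂ (p t) * q t) volume 0 x := by
      rw [intervalIntegrable_iff_integrableOn_Ioc_of_le hx0]
      exact hpq.mono_set Ioc_subset_Ioi_self
    have hi2 : IntervalIntegrable (fun t => ((‖p₁ t‖ ^ 2 : ℝ) : ℂ)) volume 0 x := by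
      rw [intervalIntegrable_iff_integrableOn_Ioc_of_le hx0]
      exact (hloc x).ofReal
    have e : starRingEnd ℂ (p x) * p₁ x = starRingEnd ℂ (p 0) * p₁ 0 +
        (((∫ t in (0 : ℝ)..x, ‖p₁ t‖ ^ 2 : ℝ) : ℂ) +
          ∫ t in (0 : ℝ)..x, starRingEnd ℂ (p t) * q t) := by
      rw [(hv x hx0).eq x ⟨hx0, le_rfl⟩, ← intervalIntegral.integral_ofReal,
        ← intervalIntegral.integral_add hi2 hi1]
      simp only [Complex.conj_mul', Complex.ofReal_pow]
    have hmono : ∫ t in (0 : ℝ)..R, ‖p₁ t‖ ^ 2 ≤ ∫ t in (0 : ℝ)..x, ‖p₁ t‖ ^ 2 := by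
      rw [intervalIntegral.integral_of_le hR0, intervalIntegral.integral_of_le hx0]
      exact setIntegral_mono_set (hloc x) (Filter.Eventually.of_forall fun _ => sq_nonneg _)
        (Filter.Eventually.of_forall (Ioc_subset_Ioc_right hx))
    have hb1 : ‖∫ t in (0 : ℝ)..x, starRingEnd ℂ (p t) * q t‖ ≤
        ∫ t in Ioi 0, ‖starRingEnd ℂ (p t) * q t‖ := by
      refine (intervalIntegral.norm_integral_le_integral_norm hx0).trans ?_
      rw [intervalIntegral.integral_of_le hx0]
      exact setIntegral_mono_set hpq.norm (Filter.Eventually.of_forall fun _ => norm_nonneg _)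
        (Filter.Eventually.of_forall Ioc_subset_Ioi_self)
    have hb2 := Complex.abs_re_le_norm (∫ t in (0 : ℝ)..x, starRingEnd ℂ (p t) * q t)
    have hb3 := Complex.abs_re_le_norm (starRingEnd ℂ (p 0) * p₁ 0)
    rw [norm_mul, RCLike.norm_conj] at hb3
    rw [e, Complex.add_re, Complex.add_re, Complex.ofReal_re]
    have := neg_abs_le (starRingEnd ℂ (p 0) * p₁ 0).re
    have := neg_abs_le (∫ t in (0 : ℝ)..x, starRingEnd ℂ (p t) * q t).re
    linarith
  -- That real part is half the derivative of `‖p‖ ^ 2`, which therefore grows at least linearly;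
  -- but it is integrable.
  have hgrow : ∀ x, R + 1 ≤ x → 1 ≤ ‖p x‖ ^ 2 := by
    intro x hx
    have hx0 : 0 ≤ x := by linarith
    have hRx : R ≤ x := by linarith
    have hi := (hw x hx0).integrable
    have hiR : IntervalIntegrable
        (fun x => starRingEnd ℂ (p₁ x) * p x + starRingEnd ℂ (p x) * p₁ x) volume R x :=
      hi.mono_set (by
        rw [uIcc_of_le hRx, uIcc_of_le hx0]; exact Icc_subset_Icc_left hR0)
    have e : starRingEnd ℂ (p x) * p x = starRingEnd ℂ (p R) * p R +
        ∫ t in R..x, (starRingEnd ℂ (p₁ t) * p t + starRingEnd ℂ (p t) * p₁ t) := by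
      rw [(hw x hx0).eq x ⟨hx0, le_rfl⟩, (hw x hx0).eq R ⟨hR0, hRx⟩, add_assoc,
        intervalIntegral.integral_add_adjacent_intervals _ hiR]
      exact (hw R hR0).integrable
    have e2 : ∀ t, (starRingEnd ℂ (p₁ t) * p t + starRingEnd ℂ (p t) * p₁ t) =
        ((2 * (starRingEnd ℂ (p t) * p₁ t).re : ℝ) : ℂ) := by
      intro t
      apply Complex.ext <;> simp <;> ring
    simp only [e2] at e hiR
    rw [intervalIntegral.integral_ofReal] at e
    have e3 := congrArg Complex.re e
    rw [Complex.add_re, Complex.ofReal_re, Complex.conj_mul', Complex.conj_mul',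
      ← Complex.ofReal_pow, ← Complex.ofReal_pow, Complex.ofReal_re, Complex.ofReal_re] at e3
    have hiR' : IntervalIntegrable (fun t => 2 * (starRingEnd ℂ (p t) * p₁ t).re) volume R x := by
      rw [intervalIntegrable_iff] at hiR ⊢
      exact hiR.re
    have hlow : ∫ t in R..x, (1 : ℝ) ≤ ∫ t in R..x, 2 * (starRingEnd ℂ (p t) * p₁ t).re :=
      intervalIntegral.integral_mono_on hRx (by simp) hiR'
        fun t ht => by linarith [hre t ht.1]
    rw [intervalIntegral.integral_const, smul_eq_mul, mul_one] at hlow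
    nlinarith [sq_nonneg ‖p R‖]
  have hpi : IntegrableOn (fun x => ‖p x‖ ^ 2) (Ioi 0) := by
    exact hp.integrable_norm_pow two_ne_zero
  have hi : IntegrableOn (fun _ : ℝ => (1 : ℝ)) (Ioi (R + 1)) := by
    refine Integrable.mono (hpi.mono_set (Ioi_subset_Ioi (by linarith)))
      aestronglyMeasurable_const ?_
    filter_upwards [ae_restrict_mem measurableSet_Ioi] with x hx
    rw [Real.norm_of_nonneg zero_le_one, Real.norm_of_nonneg (sq_nonneg _)]
    exact hgrow x (le_of_lt hx)
  rw [integrableOn_const_iff] at hi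
  simp at hi

/-! ### Test functions and the lemma of du Bois-Reymond -/

/-- A smooth real function with compact support in `U`. -/
structure IsTestFunction (U : Set ℝ) (η : ℝ → ℝ) : Prop where
  contDiff : ContDiff ℝ ∞ η
  hasCompactSupport : HasCompactSupport η
  tsupport_subset : tsupport η ⊆ U

namespace IsTestFunction

variable {U : Set ℝ} {η ζ : ℝ → ℝ} {f : ℝ → ℂ}

lemma deriv (h : IsTestFunction U η) : IsTestFunction U (deriv η) :=
  ⟨(contDiff_infty_iff_deriv.1 h.contDiff).2, h.hasCompactSupport.deriv,
    (tsupport_deriv_subset).trans h.tsupport_subset⟩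

lemma hasDerivAt (h : IsTestFunction U η) (x : ℝ) : HasDerivAt η (_root_.deriv η x) x :=
  ((contDiff_infty_iff_deriv.1 h.contDiff).1 x).hasDerivAt

lemma sub_const_mul (h : IsTestFunction U η) (h' : IsTestFunction U ζ) (c : ℝ) :
    IsTestFunction U (fun x => η x - c * ζ x) := by
  have hs : tsupport (fun x => η x - c * ζ x) ⊆ tsupport η ∪ tsupport ζ := by
    rw [tsupport, tsupport, tsupport, ← closure_union]
    refine closure_mono fun x hx => ?_
    by_contra hn
    simp only [mem_union, Function.mem_support, not_or, not_not] at hn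
    simp [hn.1, hn.2] at hx
  exact ⟨h.contDiff.sub (contDiff_const.mul h'.contDiff),
    HasCompactSupport.of_support_subset_isCompact (h.hasCompactSupport.union h'.hasCompactSupport)
      ((subset_tsupport _).trans hs), hs.trans (union_subset h.tsupport_subset h'.tsupport_subset)⟩

lemma eq_zero (h : IsTestFunction U η) {x : ℝ} (hx : x ∉ U) : η x = 0 :=
  image_eq_zero_of_notMem_tsupport fun hx' => hx (h.tsupport_subset hx')

lemma setIntegral_smul_eq (h : IsTestFunction U η) :
    ∫ x in U, η x • f x = ∫ x, η x • f x :=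
  setIntegral_eq_integral_of_forall_compl_eq_zero fun x hx => by rw [h.eq_zero hx, zero_smul]

lemma integrable_smul (h : IsTestFunction U η) (hf : LocallyIntegrableOn f U) :
    Integrable (fun x => η x • f x) := by
  have h1 : IntegrableOn f (tsupport η) :=
    hf.integrableOn_compact_subset h.tsupport_subset h.hasCompactSupport
  have h2 : IntegrableOn (fun x => η x • f x) (tsupport η) :=
    h1.continuousOn_smul h.contDiff.continuous.continuousOn h.hasCompactSupport
  refine (integrableOn_iff_integrable_of_support_subset ?_).1 h2
  exact (Function.support_smul_subset_left η f).trans (subset_tsupport η)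

lemma integrable (h : IsTestFunction U η) : Integrable η :=
  h.contDiff.continuous.integrable_of_hasCompactSupport h.hasCompactSupport

/-- A test function of mean zero is the derivative of a test function. -/
lemma exists_deriv_eq (h : IsTestFunction U η) (hU : U.OrdConnected) (h0 : ∫ x, η x = 0) :
    ∃ ζ, IsTestFunction U ζ ∧ _root_.deriv ζ = η := by
  rcases (tsupport η).eq_empty_or_nonempty with he | hne
  · refine ⟨0, ⟨contDiff_const, HasCompactSupport.zero, ?_⟩, ?_⟩
    · rw [tsupport_zero]; exact empty_subset _
    · rw [tsupport_eq_empty_iff.1 he]; exact deriv_zero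
  have hs := h.hasCompactSupport.isCompact.sInf_mem hne
  have ht := h.hasCompactSupport.isCompact.sSup_mem hne
  set s := sInf (tsupport η)
  set t := sSup (tsupport η)
  have hsub : tsupport η ⊆ Icc s t := fun x hx =>
    ⟨csInf_le h.hasCompactSupport.isCompact.bddBelow hx,
      le_csSup h.hasCompactSupport.isCompact.bddAbove hx⟩
  have hout : ∀ x, x ∉ Icc s t → η x = 0 := fun x hx =>
    image_eq_zero_of_notMem_tsupport fun hx' => hx (hsub hx')
  have hd : ∀ x, HasDerivAt (fun y => ∫ u in (s - 1)..y, η u) (η x) x := fun x =>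
    intervalIntegral.integral_hasDerivAt_right (h.contDiff.continuous.intervalIntegrable _ _)
      (h.contDiff.continuous.stronglyMeasurableAtFilter _ _) h.contDiff.continuous.continuousAt
  have hderiv : _root_.deriv (fun y => ∫ u in (s - 1)..y, η u) = η := funext fun x => (hd x).deriv
  have hsupp : Function.support (fun y => ∫ u in (s - 1)..y, η u) ⊆ Icc s t := by
    intro x hx
    by_contra hxn
    apply hx
    rw [mem_Icc, not_and_or, not_le, not_le] at hxn
    -- To the left of the support the integrand is zero; to the right the integral is the mean.
    rcases hxn with hxs | hxt
    · refine intervalIntegral.integral_zero_ae (Filter.Eventually.of_forall fun u hu => ?_)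
      refine hout u fun hu' => ?_
      rcases hu with ⟨_, h2⟩
      have : max (s - 1) x < s := max_lt (by linarith) hxs
      linarith [hu'.1]
    · rcases hne with ⟨z, hz⟩
      have hst : s ≤ t := (hsub hz).1.trans (hsub hz).2
      simp only
      rw [intervalIntegral.integral_of_le (by linarith), ← h0]
      refine setIntegral_eq_integral_of_forall_compl_eq_zero fun u hu => hout u fun hu' => hu ?_
      exact ⟨by linarith [hu'.1], hu'.2.trans hxt.le⟩
  refine ⟨_, ⟨?_, HasCompactSupport.of_support_subset_isCompact isCompact_Icc hsupp,
    (closure_minimal hsupp isClosed_Icc).trans (hU.out (h.tsupport_subset hs)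
      (h.tsupport_subset ht))⟩, hderiv⟩
  rw [contDiff_infty_iff_deriv, hderiv]
  exact ⟨fun x => (hd x).differentiableAt, h.contDiff⟩

lemma exists_integral_eq_one (hU : IsOpen U) (hne : U.Nonempty) :
    ∃ θ, IsTestFunction U θ ∧ ∫ x, θ x = 1 := by
  obtain ⟨x, hx⟩ := hne
  obtain ⟨r, hr, hrU⟩ := Metric.nhds_basis_closedBall.mem_iff.1 (hU.mem_nhds hx)
  let b : ContDiffBump x := ⟨r / 2, r, half_pos hr, half_lt_self hr⟩
  exact ⟨b.normed volume, ⟨b.contDiff_normed, b.hasCompactSupport_normed,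
    by rw [b.tsupport_normed_eq]; exact hrU⟩, b.integral_normed⟩

lemma integral_deriv_mul_id (h : IsTestFunction U η) :
    ∫ x, _root_.deriv η x * x = - ∫ x, η x := by
  have hc := h.contDiff.continuous
  have hi : Integrable (fun x => η x * x) :=
    (hc.mul continuous_id).integrable_of_hasCompactSupport h.hasCompactSupport.mul_right
  have hi' : Integrable (fun x => _root_.deriv η x * x) :=
    (h.deriv.contDiff.continuous.mul continuous_id).integrable_of_hasCompactSupport
      h.deriv.hasCompactSupport.mul_right
  have := integral_mul_deriv_eq_deriv_mul_of_integrable (u := η) (v := fun x => x)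
    (u' := _root_.deriv η) (v' := fun _ => 1)
    (fun x _ => h.hasDerivAt x) (fun x _ => hasDerivAt_id x)
    (by simpa [Pi.mul_def] using h.integrable) hi' hi
  simp only [mul_one] at this
  linarith

end IsTestFunction

variable {U : Set ℝ} {f : ℝ → ℂ}

lemma ae_eq_zero_of_forall_test (hU : IsOpen U) (hf : LocallyIntegrableOn f U)
    (h : ∀ η, IsTestFunction U η → ∫ x in U, η x • f x = 0) :
    f =ᵐ[volume.restrict U] 0 := by
  rw [Filter.EventuallyEq, ae_restrict_iff' hU.measurableSet]
  exact hU.ae_eq_zero_of_integral_contDiff_smul_eq_zero hf fun η h1 h2 h3 => by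
    have ht : IsTestFunction U η := ⟨h1, h2, h3⟩
    rw [← ht.setIntegral_smul_eq, h η ht]

/-- **Lemma of du Bois-Reymond**: a function whose distributional derivative vanishes is
constant. -/
lemma ae_eq_const_of_forall_test (hU : IsOpen U) (hUc : U.OrdConnected) (hne : U.Nonempty)
    (hf : LocallyIntegrableOn f U)
    (h : ∀ η, IsTestFunction U η → ∫ x in U, deriv η x • f x = 0) :
    ∃ c : ℂ, f =ᵐ[volume.restrict U] fun _ => c := by
  obtain ⟨θ, hθ, hθ1⟩ := IsTestFunction.exists_integral_eq_one hU hne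
  refine ⟨∫ x in U, θ x • f x, ?_⟩
  set c : ℂ := ∫ x in U, θ x • f x with hc
  -- Every test function `η` is a derivative up to the multiple `∫ η` of `θ`, and `f` annihilates
  -- derivatives.
  have hcl : LocallyIntegrableOn (fun _ : ℝ => c) U :=
    (locallyIntegrable_const c).locallyIntegrableOn U
  have key := ae_eq_zero_of_forall_test hU (hf.sub hcl) fun η hη => by
    have ht := hη.sub_const_mul hθ (∫ x, η x)
    obtain ⟨ζ, hζ, hζd⟩ := ht.exists_deriv_eq hUc (by
      rw [integral_sub hη.integrable (hθ.integrable.const_mul _), integral_const_mul, hθ1]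
      ring)
    have e := h ζ hζ
    rw [hζd] at e
    simp only [sub_smul, mul_smul] at e
    rw [integral_sub (hη.integrable_smul hf).restrict
      ((hθ.integrable_smul hf).restrict.fun_smul (∫ x, η x)), integral_smul, ← hc] at e
    simp only [Pi.sub_apply, smul_sub]
    rw [integral_sub (hη.integrable_smul hf).restrict (hη.integrable_smul hcl).restrict,
      hη.setIntegral_smul_eq (f := fun _ => c), integral_smul_const]
    exact e
  filter_upwards [key] with x hx
  exact sub_eq_zero.1 hx

/-- A function whose second distributional derivative vanishes is affine. -/
lemma ae_eq_affine_of_forall_test (hU : IsOpen U) (hUc : U.OrdConnected) (hne : U.Nonempty)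
    (hf : LocallyIntegrableOn f U)
    (h : ∀ η, IsTestFunction U η → ∫ x in U, deriv (deriv η) x • f x = 0) :
    ∃ c d : ℂ, f =ᵐ[volume.restrict U] fun x => c + d * x := by
  obtain ⟨θ, hθ, hθ1⟩ := IsTestFunction.exists_integral_eq_one hU hne
  set C : ℂ := ∫ x in U, deriv θ x • f x with hC
  -- As `f` annihilates second derivatives, its pairing with `η'` is `C ∫ η`; the function `C x` has
  -- the opposite pairing.
  have hx : LocallyIntegrableOn (fun x : ℝ => C * x) U :=
    ((continuous_const.mul Complex.continuous_ofReal).locallyIntegrable).locallyIntegrableOn U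
  obtain ⟨c, hc⟩ := ae_eq_const_of_forall_test hU hUc hne (hf.add hx) fun η hη => by
    have ht := hη.sub_const_mul hθ (∫ x, η x)
    obtain ⟨ζ, hζ, hζd⟩ := ht.exists_deriv_eq hUc (by
      rw [integral_sub hη.integrable (hθ.integrable.const_mul _), integral_const_mul, hθ1]
      ring)
    have e := h ζ hζ
    have ed : deriv (fun x => η x - (∫ x, η x) * θ x) =
        fun x => deriv η x - (∫ x, η x) * deriv θ x :=
      funext fun x => ((hη.hasDerivAt x).sub ((hθ.hasDerivAt x).const_mul _)).deriv
    rw [hζd, ed] at e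
    simp only [sub_smul, mul_smul] at e
    rw [integral_sub (hη.deriv.integrable_smul hf).restrict
      ((hθ.deriv.integrable_smul hf).restrict.fun_smul (∫ x, η x)), integral_smul, ← hC] at e
    simp only [Pi.add_apply, smul_add]
    have e2 : ∫ x, deriv η x • (C * (x : ℂ)) = -((∫ x, η x) • C) := by
      have : ∀ x : ℝ, deriv η x • (C * (x : ℂ)) = (deriv η x * x) • C := fun x => by
        simp only [Complex.real_smul, Complex.ofReal_mul]; ring
      simp only [this]
      rw [integral_smul_const, hη.integral_deriv_mul_id, neg_smul]
    rw [integral_add (hη.deriv.integrable_smul hf).restrict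
      (hη.deriv.integrable_smul hx).restrict,
      hη.deriv.setIntegral_smul_eq (f := fun x : ℝ => C * (x : ℂ)), e2, ← sub_eq_add_neg]
    exact e
  refine ⟨c, -C, ?_⟩
  filter_upwards [hc] with x hx
  rw [← hx, Pi.add_apply]
  ring

/-! ### Functions on a single edge -/

section Edge

variable {E I : Type*} {a : EdgeLengths I} {j : E ⊕ I}

lemma openEdge_ordConnected : (openEdge a j).OrdConnected := by
  cases j
  · exact ordConnected_Ioi
  · exact ordConnected_Ioo

lemma openEdge_nonempty : (openEdge a j).Nonempty := by
  cases j with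
  | inl e => exact nonempty_Ioi
  | inr i => exact nonempty_Ioo.2 (a.pos i)

lemma nonneg_of_mem_edge {x : ℝ} (hx : x ∈ edge a j) : 0 ≤ x := by
  cases j with
  | inl e => exact hx
  | inr i => exact hx.1

lemma zero_notMem_openEdge : (0 : ℝ) ∉ openEdge a j := by
  cases j with
  | inl e => exact self_notMem_Ioi
  | inr i => exact fun h => lt_irrefl _ h.1

lemma Icc_subset_edge {b : ℝ} (hb : b ∈ edge a j) : Icc 0 b ⊆ edge a j := by
  cases j with
  | inl e => exact Icc_subset_Ici_self
  | inr i => exact Icc_subset_Icc_right hb.2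

lemma Ioo_subset_openEdge {b : ℝ} (hb : b ∈ edge a j) : Ioo 0 b ⊆ openEdge a j := by
  cases j with
  | inl e => exact Ioo_subset_Ioi_self
  | inr i => exact Ioo_subset_Ioo_right hb.2

lemma edge_ae_eq_openEdge : edge a j =ᵐ[volume] openEdge a j := by
  cases j with
  | inl e => exact Ioi_ae_eq_Ici.symm
  | inr i => exact Ioo_ae_eq_Icc.symm

lemma uniqueDiffOn_edge : UniqueDiffOn ℝ (edge a j) := by
  cases j with
  | inl e => exact uniqueDiffOn_Ici 0
  | inr i => exact uniqueDiffOn_Icc (a.pos i)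

lemma edge_subset_closure_interior : edge a j ⊆ closure (interior (edge a j)) := by
  cases j with
  | inl e => simp [edge]
  | inr i => simp [edge, closure_Ioo (a.pos i).ne]

/-- Continuous functions on the closed edge which agree almost everywhere agree everywhere. -/
lemma eqOn_edge_of_ae_eq {f g : ℝ → ℂ} (hf : ContinuousOn f (edge a j))
    (hg : ContinuousOn g (edge a j)) (h : f =ᵐ[edgeMeasure a j] g) : EqOn f g (edge a j) := by
  refine Measure.eqOn_of_ae_eq (μ := volume) ?_ hf hg edge_subset_closure_interior
  rwa [Measure.restrict_congr_set edge_ae_eq_openEdge]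

lemma intervalIntegrable_of_memLp {f : ℝ → ℂ} (hf : MemLp f 2 (edgeMeasure a j)) {b : ℝ}
    (hb : b ∈ edge a j) : IntervalIntegrable f volume 0 b := by
  rw [intervalIntegrable_iff_integrableOn_Ioo_of_le (nonneg_of_mem_edge hb)]
  have h : MemLp f 2 (volume.restrict (Ioo 0 b)) :=
    hf.mono_measure (Measure.restrict_mono_set _ (Ioo_subset_openEdge hb))
  exact h.integrable (by norm_num)

lemma locallyIntegrableOn_of_memLp {f : ℝ → ℂ} (hf : MemLp f 2 (edgeMeasure a j)) :
    LocallyIntegrableOn f (openEdge a j) := by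
  have : LocallyIntegrable f (edgeMeasure a j) := hf.locallyIntegrable (by norm_num)
  intro x hx
  obtain ⟨u, hu, hi⟩ := this x
  refine ⟨u ∩ openEdge a j, Filter.inter_mem (mem_nhdsWithin_of_mem_nhds hu)
    self_mem_nhdsWithin, ?_⟩
  rwa [IntegrableOn, Measure.restrict_restrict' (isOpen_openEdge j).measurableSet] at hi

lemma locallyIntegrableOn_of_continuousOn {f : ℝ → ℂ} (hf : ContinuousOn f (edge a j)) :
    LocallyIntegrableOn f (openEdge a j) :=
  (hf.mono (openEdge_subset_edge j)).locallyIntegrableOn (isOpen_openEdge j).measurableSet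

/-- The product of square integrable functions is integrable. -/
lemma integrable_conj_mul {f g : ℝ → ℂ} (hf : MemLp f 2 (edgeMeasure a j))
    (hg : MemLp g 2 (edgeMeasure a j)) :
    Integrable (fun x => starRingEnd ℂ (f x) * g x) (edgeMeasure a j) :=
  memLp_one_iff_integrable.1 (hg.smul (p := 2) (q := 2) (r := 1) hf.star)

lemma memLp_unimodular_mul {u f : ℝ → ℂ} (hu : Continuous u) (hu1 : ∀ x, ‖u x‖ = 1)
    (hf : MemLp f 2 (edgeMeasure a j)) : MemLp (fun x => u x * f x) 2 (edgeMeasure a j) :=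
  hf.of_le (hu.aestronglyMeasurable.mul hf.1)
    (Filter.Eventually.of_forall fun x => by rw [norm_mul, hu1, one_mul])

/-- The retraction of the line onto the closed edge. -/
def edgeProj (a : EdgeLengths I) : E ⊕ I → ℝ → ℝ
  | Sum.inl _, x => max 0 x
  | Sum.inr i, x => max 0 (min x (a.len i))

lemma continuous_edgeProj : Continuous (edgeProj a j) := by
  cases j with
  | inl e => exact (by fun_prop : Continuous fun x : ℝ => max 0 x)
  | inr i => exact (by fun_prop : Continuous fun x : ℝ => max 0 (min x (a.len i)))

lemma edgeProj_mem (x : ℝ) : edgeProj a j x ∈ edge a j := by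
  cases j with
  | inl e => exact le_max_left (0 : ℝ) x
  | inr i => exact ⟨le_max_left _ _, max_le (a.pos i).le (min_le_right _ _)⟩

lemma edgeProj_eq {x : ℝ} (hx : x ∈ edge a j) : edgeProj a j x = x := by
  cases j with
  | inl e => exact max_eq_right hx
  | inr i => simp only [edgeProj]; rw [min_eq_left hx.2, max_eq_right hx.1]

lemma continuous_comp_edgeProj {X : Type*} [TopologicalSpace X] {f : ℝ → X}
    (hf : ContinuousOn f (edge a j)) : Continuous fun x => f (edgeProj a j x) :=
  hf.comp_continuous continuous_edgeProj edgeProj_mem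

/-! ### Primitives on an edge -/

/-- `F` is a primitive of `f` on the closed edge. -/
def IsEdgePrimitive (a : EdgeLengths I) (j : E ⊕ I) (F f : ℝ → ℂ) : Prop :=
  ∀ b ∈ edge a j, IsPrimitive F f b

/-- The value of a function at the far end of an edge; for an external edge, where this will be
the limit at infinity of integrable functions, it is taken to be zero. -/
def endValue (a : EdgeLengths I) : E ⊕ I → (ℝ → ℂ) → ℂ
  | Sum.inl _, _ => 0
  | Sum.inr i, w => w (a.len i)

namespace IsEdgePrimitive

variable {F G f g : ℝ → ℂ}

lemma congr (h : IsEdgePrimitive a j F f) (hFG : EqOn F G (edge a j))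
    (hfg : f =ᵐ[edgeMeasure a j] g) : IsEdgePrimitive a j G g := by
  intro b hb
  refine (h b hb).congr (hFG.mono (Icc_subset_edge hb)) ?_
  rw [Filter.EventuallyEq, ae_restrict_iff' (isOpen_openEdge j).measurableSet] at hfg
  filter_upwards [hfg] with x hx hxb
  exact hx (Ioo_subset_openEdge hb hxb)

lemma continuousOn (h : IsEdgePrimitive a j F f) : ContinuousOn F (edge a j) := by
  cases j with
  | inr i => exact (h _ (len_mem_edge a i)).continuousOn
  | inl e =>
    intro x hx
    have hx0 : 0 ≤ x := hx
    have hb : x + 1 ∈ edge a (Sum.inl e : E ⊕ I) := by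
      change 0 ≤ x + 1
      linarith
    refine ((h _ hb).continuousOn x ⟨hx, by linarith⟩).mono_of_mem_nhdsWithin ?_
    have : Icc 0 (x + 1) = Ici 0 ∩ Iic (x + 1) := rfl
    rw [this]
    exact Filter.inter_mem self_mem_nhdsWithin
      (mem_nhdsWithin_of_mem_nhds (Iic_mem_nhds (by linarith)))

lemma of_memLp (hf : MemLp f 2 (edgeMeasure a j)) (c : ℂ) :
    IsEdgePrimitive a j (fun x => c + ∫ t in (0 : ℝ)..x, f t) f := fun _ hb =>
  IsPrimitive.of_intervalIntegrable (nonneg_of_mem_edge hb) (intervalIntegrable_of_memLp hf hb) c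

lemma of_continuousOn (hf : ContinuousOn f (edge a j)) (c : ℂ) :
    IsEdgePrimitive a j (fun x => c + ∫ t in (0 : ℝ)..x, f t) f := fun b hb => by
  have h0 := nonneg_of_mem_edge hb
  refine IsPrimitive.of_intervalIntegrable h0 (ContinuousOn.intervalIntegrable ?_) c
  rw [uIcc_of_le h0]
  exact hf.mono (Icc_subset_edge hb)

/-- The fundamental theorem of calculus on an edge. -/
lemma integral_eq (h : IsEdgePrimitive a j F f) (hF : Integrable F (edgeMeasure a j))
    (hf : Integrable f (edgeMeasure a j)) :
    ∫ x in openEdge a j, f x = endValue a j F - F 0 := by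
  cases j with
  | inl e =>
    rw [endValue, zero_sub]
    exact integral_Ioi_of_isPrimitive h hF hf
  | inr i =>
    have h1 := (h _ (len_mem_edge a i)).eq _ ⟨(a.pos i).le, le_rfl⟩
    rw [intervalIntegral.integral_of_le (a.pos i).le, integral_Ioc_eq_integral_Ioo] at h1
    simp only [endValue, openEdge]
    rw [h1]
    ring

/-- The derivative of a primitive in the sense of distributions. -/
lemma integral_deriv_smul_eq (h : IsEdgePrimitive a j F f)
    (hf : LocallyIntegrableOn f (openEdge a j)) {η : ℝ → ℝ}
    (hη : IsTestFunction (openEdge a j) η) :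
    ∫ x in openEdge a j, deriv η x • F x = - ∫ x in openEdge a j, η x • f x := by
  have hF := locallyIntegrableOn_of_continuousOn h.continuousOn
  have hp : IsEdgePrimitive a j (fun x => (η x : ℂ) * F x)
      (fun x => ((deriv η x : ℝ) : ℂ) * F x + (η x : ℂ) * f x) := fun b hb =>
    (IsPrimitive.of_hasDerivAt (nonneg_of_mem_edge hb) (fun x => (hη.hasDerivAt x).ofReal_comp)
      (Complex.continuous_ofReal.comp hη.deriv.contDiff.continuous)).mul (h b hb)
  have i0 := (hη.integrable_smul hF).restrict (s := openEdge a j)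
  have i1 := (hη.deriv.integrable_smul hF).restrict (s := openEdge a j)
  have i2 := (hη.integrable_smul hf).restrict (s := openEdge a j)
  simp only [Complex.real_smul] at i0 i1 i2 ⊢
  have e := hp.integral_eq i0 (i1.add i2)
  have hend : endValue a j (fun x => (η x : ℂ) * F x) = 0 := by
    cases j with
    | inl e => rfl
    | inr i =>
      have : a.len i ∉ openEdge a (Sum.inr i : E ⊕ I) := fun h => lt_irrefl _ h.2
      simp only [endValue, hη.eq_zero this, Complex.ofReal_zero, zero_mul]
  rw [hend, hη.eq_zero zero_notMem_openEdge, integral_add i1 i2] at e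
  simp only [Complex.ofReal_zero, zero_mul, sub_zero] at e
  exact eq_neg_of_add_eq_zero_left e

/-- Conversely, a function with a square integrable distributional derivative is a primitive. -/
lemma exists_of_forall_test (hF : LocallyIntegrableOn F (openEdge a j))
    (hf : MemLp f 2 (edgeMeasure a j))
    (h : ∀ η, IsTestFunction (openEdge a j) η →
      ∫ x in openEdge a j, deriv η x • F x = - ∫ x in openEdge a j, η x • f x) :
    ∃ G, G =ᵐ[edgeMeasure a j] F ∧ IsEdgePrimitive a j G f := by
  have hP := of_memLp hf 0
  have hPl := locallyIntegrableOn_of_continuousOn hP.continuousOn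
  obtain ⟨c, hc⟩ := ae_eq_const_of_forall_test (isOpen_openEdge j) openEdge_ordConnected
    openEdge_nonempty (hF.sub hPl) fun η hη => by
      simp only [Pi.sub_apply, smul_sub]
      rw [integral_sub (hη.deriv.integrable_smul hF).restrict
        (hη.deriv.integrable_smul hPl).restrict, h η hη,
        hP.integral_deriv_smul_eq (locallyIntegrableOn_of_memLp hf) hη, sub_self]
  refine ⟨_, ?_, of_memLp hf c⟩
  filter_upwards [hc] with x hx
  rw [Pi.sub_apply, sub_eq_iff_eq_add] at hx
  rw [hx, zero_add]

/-- A primitive of a continuous function is continuously differentiable up to the ends. -/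
lemma hasDerivWithinAt_and_contDiffOn (h : IsEdgePrimitive a j F f)
    (hf : ContinuousOn f (edge a j)) {x : ℝ} (hx : x ∈ edge a j) :
    HasDerivWithinAt F (f x) (edge a j) x ∧ ContDiffOn ℝ 1 F (edge a j) := by
  have hc := continuous_comp_edgeProj hf
  have hd : ∀ y, HasDerivAt (fun y => F 0 + ∫ t in (0 : ℝ)..y, f (edgeProj a j t))
      (f (edgeProj a j y)) y := fun y =>
    (intervalIntegral.integral_hasDerivAt_right (hc.intervalIntegrable _ _)
      (hc.stronglyMeasurableAtFilter _ _) hc.continuousAt).const_add _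
  have heq : ∀ y ∈ edge a j, F y = F 0 + ∫ t in (0 : ℝ)..y, f (edgeProj a j t) := by
    intro y hy
    have hy0 := nonneg_of_mem_edge hy
    rw [(h y hy).eq y ⟨hy0, le_rfl⟩]
    congr 1
    refine intervalIntegral.integral_congr fun t ht => ?_
    rw [uIcc_of_le hy0] at ht
    simp only [edgeProj_eq (Icc_subset_edge hy ht)]
  refine ⟨?_, ?_⟩
  · have := (hd x).hasDerivWithinAt (s := edge a j)
    rw [edgeProj_eq hx] at this
    exact this.congr heq (heq x hx)
  · refine ContDiff.contDiffOn ?_ |>.congr heq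
    rw [contDiff_one_iff_deriv]
    refine ⟨fun y => (hd y).differentiableAt, ?_⟩
    rw [funext fun y => (hd y).deriv]
    exact hc

end IsEdgePrimitive

/-- A square integrable function with a square integrable second derivative, in the sense of
distributions, has a square integrable first derivative. -/
lemma exists_primitives_of_second_deriv {p q : ℝ → ℂ} (hp : MemLp p 2 (edgeMeasure a j))
    (hq : MemLp q 2 (edgeMeasure a j))
    (h : ∀ η, IsTestFunction (openEdge a j) η →
      ∫ x in openEdge a j, deriv (deriv η) x • p x = ∫ x in openEdge a j, η x • q x) :
    ∃ P P₁, P =ᵐ[edgeMeasure a j] p ∧ IsEdgePrimitive a j P P₁ ∧ IsEdgePrimitive a j P₁ q ∧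
      MemLp P₁ 2 (edgeMeasure a j) := by
  have hQ := IsEdgePrimitive.of_memLp hq 0
  have hR := IsEdgePrimitive.of_continuousOn hQ.continuousOn 0
  set Q : ℝ → ℂ := fun x => 0 + ∫ t in (0 : ℝ)..x, q t
  set R : ℝ → ℂ := fun x => 0 + ∫ t in (0 : ℝ)..x, Q t
  have hpl := locallyIntegrableOn_of_memLp hp
  have hRl := locallyIntegrableOn_of_continuousOn hR.continuousOn
  -- The double primitive `R` of `q` differs from `p` by an affine function.
  obtain ⟨c, d, hcd⟩ := ae_eq_affine_of_forall_test (isOpen_openEdge j) openEdge_ordConnected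
    openEdge_nonempty (hpl.sub hRl) fun η hη => by
      simp only [Pi.sub_apply, smul_sub]
      rw [integral_sub (hη.deriv.deriv.integrable_smul hpl).restrict
        (hη.deriv.deriv.integrable_smul hRl).restrict, h η hη,
        hR.integral_deriv_smul_eq (locallyIntegrableOn_of_continuousOn hQ.continuousOn) hη.deriv,
        hQ.integral_deriv_smul_eq (locallyIntegrableOn_of_memLp hq) hη, neg_neg, sub_self]
  have hlin : IsEdgePrimitive a j (fun x => c + d * x) (fun _ => d) := fun b hb => by
    refine IsPrimitive.of_hasDerivAt (nonneg_of_mem_edge hb) (fun x => ?_) continuous_const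
    simpa using ((Complex.ofRealCLM.hasDerivAt (x := x)).const_mul d).const_add c
  have hconst : IsEdgePrimitive a j (fun _ => d) (fun _ => 0) := fun b hb =>
    IsPrimitive.of_hasDerivAt (nonneg_of_mem_edge hb) (fun x => hasDerivAt_const _ _)
      continuous_const
  have h1 : IsEdgePrimitive a j (fun x => (c + d * x) + R x) (fun x => d + Q x) :=
    fun b hb => (hlin b hb).add (hR b hb)
  have h2 : IsEdgePrimitive a j (fun x => d + Q x) q := fun b hb => by
    simpa using (hconst b hb).add (hQ b hb)
  have hae : (fun x : ℝ => (c + d * x) + R x) =ᵐ[edgeMeasure a j] p := by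
    filter_upwards [hcd] with x hx
    rw [← hx, Pi.sub_apply, sub_add_cancel]
  have hm : AEStronglyMeasurable (fun x => d + Q x) (edgeMeasure a j) :=
    (h2.continuousOn.mono (openEdge_subset_edge j)).aestronglyMeasurable
      (isOpen_openEdge j).measurableSet
  refine ⟨_, _, hae, h1, h2, ?_⟩
  cases j with
  | inl e =>
    rw [memLp_two_iff_integrable_sq_norm hm]
    exact integrableOn_norm_sq_of_second_deriv h1 h2 (hp.ae_eq hae.symm) hq
  | inr i =>
    obtain ⟨C, hC⟩ := isCompact_Icc.exists_bound_of_continuousOn h2.continuousOn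
    have : IsFiniteMeasure (edgeMeasure a (Sum.inr i : E ⊕ I)) :=
      ⟨by simp [openEdge]⟩
    refine MemLp.of_bound hm C ?_
    filter_upwards [ae_restrict_mem (isOpen_openEdge (Sum.inr i : E ⊕ I)).measurableSet] with x hx
    exact hC x (openEdge_subset_edge _ hx)

/-! ### Magnetic primitives and Green's identity -/

variable {𝒜 : VectorPotential E a}

/-- `F` is absolutely continuous on the closed edge, with magnetic derivative `g` almost
everywhere. -/
def IsMagneticPrimitive (𝒜 : VectorPotential E a) (j : E ⊕ I) (F g : ℝ → ℂ) : Prop :=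
  IsEdgePrimitive a j F (fun x => g x + Complex.I * (𝒜.toFun j x : ℂ) * F x)

lemma IsMagneticPrimitive.congr {F G f g : ℝ → ℂ} (h : IsMagneticPrimitive 𝒜 j F f)
    (hFG : EqOn F G (edge a j)) (hfg : f =ᵐ[edgeMeasure a j] g) :
    IsMagneticPrimitive 𝒜 j G g := by
  refine IsEdgePrimitive.congr h hFG ?_
  filter_upwards [hfg, ae_restrict_mem (isOpen_openEdge j).measurableSet] with x hx hxj
  rw [hx, hFG (openEdge_subset_edge j hxj)]

lemma continuousOn_potential_mul {F : ℝ → ℂ} (hF : ContinuousOn F (edge a j)) :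
    ContinuousOn (fun x => Complex.I * (𝒜.toFun j x : ℂ) * F x) (edge a j) :=
  (continuousOn_const.mul
    (Complex.continuous_ofReal.comp_continuousOn (𝒜.continuousOn j))).mul hF

lemma IsMagneticPrimitive.isWeakMagneticDeriv {F g : ℝ → ℂ} (h : IsMagneticPrimitive 𝒜 j F g)
    (hg : LocallyIntegrableOn g (openEdge a j)) : IsWeakMagneticDeriv 𝒜 j F g :=
  fun _ h1 h2 h3 => h.integral_deriv_smul_eq
    (hg.add (locallyIntegrableOn_of_continuousOn (continuousOn_potential_mul h.continuousOn)))
    ⟨h1, h2, h3⟩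

lemma exists_isMagneticPrimitive {f g : ℝ → ℂ} (h : IsWeakMagneticDeriv 𝒜 j f g)
    (hf : MemLp f 2 (edgeMeasure a j)) (hg : MemLp g 2 (edgeMeasure a j)) :
    ∃ F, F =ᵐ[edgeMeasure a j] f ∧ IsMagneticPrimitive 𝒜 j F g := by
  obtain ⟨F, hF, hFp⟩ := IsEdgePrimitive.exists_of_forall_test (locallyIntegrableOn_of_memLp hf)
    (hg.add (memLp_potential_mul 𝒜 hf)) fun η hη =>
      h η hη.contDiff hη.hasCompactSupport hη.tsupport_subset
  refine ⟨F, hF, IsEdgePrimitive.congr hFp (fun _ _ => rfl) ?_⟩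
  filter_upwards [hF] with x hx
  simp only [Pi.add_apply, hx]

lemma IsMagneticPrimitive.derivWithin_eq {F g : ℝ → ℂ} (h : IsMagneticPrimitive 𝒜 j F g)
    (hg : ContinuousOn g (edge a j)) {x : ℝ} (hx : x ∈ edge a j) :
    derivWithin F (edge a j) x = g x + Complex.I * (𝒜.toFun j x : ℂ) * F x :=
  (h.hasDerivWithinAt_and_contDiffOn
    (hg.add (continuousOn_potential_mul h.continuousOn)) hx).1.derivWithin (uniqueDiffOn_edge x hx)

lemma IsMagneticPrimitive.contDiffOn {F g : ℝ → ℂ} (h : IsMagneticPrimitive 𝒜 j F g)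
    (hg : ContinuousOn g (edge a j)) : ContDiffOn ℝ 1 F (edge a j) :=
  (h.hasDerivWithinAt_and_contDiffOn (hg.add (continuousOn_potential_mul h.continuousOn))
    (zero_mem_edge a j)).2

/-- **Green's identity** on an edge: the potential, being real, drops out. -/
lemma integral_green {F K f F' K' f' : ℝ → ℂ} (hF : IsMagneticPrimitive 𝒜 j F K)
    (hK : IsMagneticPrimitive 𝒜 j K f) (hF' : IsMagneticPrimitive 𝒜 j F' K')
    (hK' : IsMagneticPrimitive 𝒜 j K' f')
    (mF : MemLp F 2 (edgeMeasure a j)) (mK : MemLp K 2 (edgeMeasure a j))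
    (mf : MemLp f 2 (edgeMeasure a j)) (mF' : MemLp F' 2 (edgeMeasure a j))
    (mK' : MemLp K' 2 (edgeMeasure a j)) (mf' : MemLp f' 2 (edgeMeasure a j)) :
    (∫ x in openEdge a j, starRingEnd ℂ (f x) * F' x) -
        ∫ x in openEdge a j, starRingEnd ℂ (F x) * f' x =
      endValue a j (fun x => starRingEnd ℂ (K x) * F' x - starRingEnd ℂ (F x) * K' x) -
        (starRingEnd ℂ (K 0) * F' 0 - starRingEnd ℂ (F 0) * K' 0) := by
  have hw : IsEdgePrimitive a j
      (fun x => starRingEnd ℂ (K x) * F' x - starRingEnd ℂ (F x) * K' x)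
      (fun x => starRingEnd ℂ (f x) * F' x - starRingEnd ℂ (F x) * f' x) := fun b hb => by
    have := ((hK b hb).conj.mul (hF' b hb)).add ((hF b hb).conj.mul (hK' b hb)).neg
    refine this.congr (fun x _ => (sub_eq_add_neg _ _).symm)
      (Filter.Eventually.of_forall fun x _ => ?_)
    simp only [map_add, map_mul, Complex.conj_I, Complex.conj_ofReal]
    ring
  rw [← integral_sub (integrable_conj_mul mf mF') (integrable_conj_mul mF mf')]
  exact hw.integral_eq ((integrable_conj_mul mK mF').sub (integrable_conj_mul mF mK'))
    ((integrable_conj_mul mf mF').sub (integrable_conj_mul mF mf'))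

/-! ### The gauge transformation -/

/-- The phase factor `exp (i ∫₀ˣ 𝒜ⱼ)`, which removes the potential from the edge `j`. The potential
is extended to the line by its values at the ends of the edge. -/
noncomputable def gauge (𝒜 : VectorPotential E a) (j : E ⊕ I) (x : ℝ) : ℂ :=
  Complex.exp (((∫ t in (0 : ℝ)..x, 𝒜.toFun j (edgeProj a j t) : ℝ) : ℂ) * Complex.I)

lemma hasDerivAt_gauge (x : ℝ) : HasDerivAt (gauge 𝒜 j)
    (Complex.I * (𝒜.toFun j (edgeProj a j x) : ℂ) * gauge 𝒜 j x) x := by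
  have hc := continuous_comp_edgeProj (𝒜.continuousOn j)
  have hd : HasDerivAt (fun y => ∫ t in (0 : ℝ)..y, 𝒜.toFun j (edgeProj a j t))
      (𝒜.toFun j (edgeProj a j x)) x :=
    intervalIntegral.integral_hasDerivAt_right (hc.intervalIntegrable _ _)
      (hc.stronglyMeasurableAtFilter _ _) hc.continuousAt
  convert! (hd.ofReal_comp.mul_const Complex.I).cexp using 1
  rw [gauge]
  ring

lemma continuous_gauge : Continuous (gauge 𝒜 j) :=
  continuous_iff_continuousAt.2 fun x => (hasDerivAt_gauge x).continuousAt

lemma norm_gauge (x : ℝ) : ‖gauge 𝒜 j x‖ = 1 := Complex.norm_exp_ofReal_mul_I _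

lemma gauge_ne_zero (x : ℝ) : gauge 𝒜 j x ≠ 0 := Complex.exp_ne_zero _

lemma gauge_zero : gauge 𝒜 j 0 = 1 := by simp [gauge]

lemma gauge_mul_conj (x : ℝ) : gauge 𝒜 j x * starRingEnd ℂ (gauge 𝒜 j x) = 1 := by
  rw [Complex.mul_conj', norm_gauge]; simp

/-- The gauge transformation turns derivatives into magnetic derivatives. -/
lemma IsEdgePrimitive.gauge_mul {p p₁ : ℝ → ℂ} (h : IsEdgePrimitive a j p p₁) :
    IsMagneticPrimitive 𝒜 j (fun x => gauge 𝒜 j x * p x) (fun x => gauge 𝒜 j x * p₁ x) := by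
  intro b hb
  have hc : Continuous fun x =>
      Complex.I * (𝒜.toFun j (edgeProj a j x) : ℂ) * gauge 𝒜 j x :=
    (continuous_const.mul (Complex.continuous_ofReal.comp
      (continuous_comp_edgeProj (𝒜.continuousOn j)))).mul continuous_gauge
  refine ((IsPrimitive.of_hasDerivAt (nonneg_of_mem_edge hb) hasDerivAt_gauge hc).mul
    (h b hb)).congr (fun _ _ => rfl) (Filter.Eventually.of_forall fun x hx => ?_)
  rw [edgeProj_eq (Icc_subset_edge hb (Ioo_subset_Icc_self hx))]
  ring

/-- A pair of square integrable functions which is orthogonal, in the sense of the adjoint, to the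
gauge transforms of all test functions belongs to the maximal operator. -/
lemma exists_isWeakMagneticDeriv_of_forall_test {f g : ℝ → ℂ} (hf : MemLp f 2 (edgeMeasure a j))
    (hg : MemLp g 2 (edgeMeasure a j))
    (h : ∀ η, IsTestFunction (openEdge a j) η →
      ∫ x in openEdge a j, starRingEnd ℂ (gauge 𝒜 j x * ((deriv (deriv η) x : ℝ) : ℂ)) * f x =
        ∫ x in openEdge a j, starRingEnd ℂ (gauge 𝒜 j x * (η x : ℂ)) * g x) :
    ∃ K, MemLp K 2 (edgeMeasure a j) ∧ IsWeakMagneticDeriv 𝒜 j f K ∧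
      IsWeakMagneticDeriv 𝒜 j K g := by
  have hcc : Continuous fun x => starRingEnd ℂ (gauge 𝒜 j x) :=
    Complex.continuous_conj.comp continuous_gauge
  have hcn : ∀ x, ‖starRingEnd ℂ (gauge 𝒜 j x)‖ = 1 := fun x => by
    rw [RCLike.norm_conj, norm_gauge]
  have hp := memLp_unimodular_mul hcc hcn hf
  have hq := memLp_unimodular_mul hcc hcn hg
  obtain ⟨P, P₁, hPf, hP, hP₁, hm⟩ := exists_primitives_of_second_deriv hp hq fun η hη => by
    convert h η hη using 2 <;>
    · ext x
      simp only [Complex.real_smul, map_mul, Complex.conj_ofReal]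
      ring
  have hGm := memLp_unimodular_mul (continuous_gauge (𝒜 := 𝒜) (j := j)) norm_gauge hm
  have hGq := memLp_unimodular_mul (continuous_gauge (𝒜 := 𝒜) (j := j)) norm_gauge hq
  refine ⟨_, hGm, ?_, ?_⟩
  · refine ((hP.gauge_mul (𝒜 := 𝒜)).isWeakMagneticDeriv
      (locallyIntegrableOn_of_memLp hGm)).congr ?_ Filter.EventuallyEq.rfl
    filter_upwards [hPf] with x hx
    rw [hx, ← mul_assoc, gauge_mul_conj, one_mul]
  · refine ((hP₁.gauge_mul (𝒜 := 𝒜)).isWeakMagneticDeriv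
      (locallyIntegrableOn_of_memLp hGq)).congr Filter.EventuallyEq.rfl ?_
    refine Filter.Eventually.of_forall fun x => ?_
    simp only [← mul_assoc, gauge_mul_conj, one_mul]

end Edge

/-! ### Boundary values of functions in the maximal domain -/

section BoundaryMap

variable {E I : Type*} [Fintype E] [Fintype I] {a : EdgeLengths I}

/-- The vector `({Kₑ(0)}, {Kᵢ(0)}, {-Kᵢ(aᵢ)})`. -/
def inwardValue (a : EdgeLengths I) (K : E ⊕ I → ℝ → ℂ) : Ends E I → ℂ
  | Sum.inl e => K (Sum.inl e) 0
  | Sum.inr (Sum.inl i) => K (Sum.inr i) 0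
  | Sum.inr (Sum.inr i) => - K (Sum.inr i) (a.len i)

/-- `F` and `K` are absolutely continuous representatives of a function on the graph and of its
magnetic derivative; the pair `p` consists of that function and its second magnetic derivative. -/
structure IsRegularRepresentative (𝒜 : VectorPotential E a) (p : GraphL2 E a × GraphL2 E a)
    (F K : E ⊕ I → ℝ → ℂ) : Prop where
  ae_eq : ∀ j, F j =ᵐ[edgeMeasure a j] p.1 j
  primitive : ∀ j, IsMagneticPrimitive 𝒜 j (F j) (K j)
  deriv_primitive : ∀ j, IsMagneticPrimitive 𝒜 j (K j) (p.2 j)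
  memLp : ∀ j, MemLp (K j) 2 (edgeMeasure a j)

variable {𝒜 : VectorPotential E a} {p q : GraphL2 E a × GraphL2 E a}
  {F K F' K' : E ⊕ I → ℝ → ℂ}

lemma exists_isRegularRepresentative (hp : p ∈ maximalGraph 𝒜) :
    ∃ F K, IsRegularRepresentative 𝒜 p F K := by
  obtain ⟨χ, hχ⟩ := hp
  choose K hK hKp using fun j =>
    exists_isMagneticPrimitive (hχ j).2 (Lp.memLp (χ j)) (Lp.memLp (p.2 j))
  choose F hF hFp using fun j =>
    exists_isMagneticPrimitive (hχ j).1 (Lp.memLp (p.1 j)) (Lp.memLp (χ j))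
  exact ⟨F, K, hF, fun j => (hFp j).congr (fun _ _ => rfl) (hK j).symm, hKp,
    fun j => (Lp.memLp (χ j)).ae_eq (hK j).symm⟩

namespace IsRegularRepresentative

lemma mem_maximalGraph (h : IsRegularRepresentative 𝒜 p F K) : p ∈ maximalGraph 𝒜 := by
  refine ⟨WithLp.toLp 2 fun j => (h.memLp j).toLp, fun j => ⟨?_, ?_⟩⟩
  · exact ((h.primitive j).isWeakMagneticDeriv (locallyIntegrableOn_of_memLp (h.memLp j))).congr
      (h.ae_eq j) (h.memLp j).coeFn_toLp.symm
  · exact ((h.deriv_primitive j).isWeakMagneticDeriv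
      (locallyIntegrableOn_of_memLp (Lp.memLp (p.2 j)))).congr
      (h.memLp j).coeFn_toLp.symm Filter.EventuallyEq.rfl

lemma isC1Representative (h : IsRegularRepresentative 𝒜 p F K) : IsC1Representative p.1 F :=
  fun j => ⟨(h.primitive j).contDiffOn (h.deriv_primitive j).continuousOn, h.ae_eq j⟩

lemma boundaryMagneticDeriv_eq [DecidableEq E] [DecidableEq I]
    (h : IsRegularRepresentative 𝒜 p F K) :
    boundaryMagneticDeriv 𝒜 F = inwardValue a K := by
  have key : ∀ j, ∀ x ∈ edge a j, derivWithin (F j) (edge a j) x =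
      K j x + Complex.I * (𝒜.toFun j x : ℂ) * F j x := fun j x hx =>
    (h.primitive j).derivWithin_eq (h.deriv_primitive j).continuousOn hx
  ext (e | i | i) <;>
    simp only [boundaryMagneticDeriv, Pi.sub_apply, Pi.smul_apply, Matrix.mulVec_diagonal,
      boundaryDeriv, boundaryPotential, boundaryValue, inwardValue, smul_eq_mul]
  · rw [key _ _ (zero_mem_edge a _)]
    ring
  · rw [key _ _ (zero_mem_edge a _)]
    ring
  · rw [key _ _ (len_mem_edge a i)]
    ring

end IsRegularRepresentative

lemma IsC1Representative.eqOn {ψ : GraphL2 E a} {f g : E ⊕ I → ℝ → ℂ}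
    (hf : IsC1Representative ψ f) (hg : IsC1Representative ψ g) (j : E ⊕ I) :
    EqOn (f j) (g j) (edge a j) :=
  eqOn_edge_of_ae_eq (hf j).1.continuousOn (hg j).1.continuousOn ((hf j).2.trans (hg j).2.symm)

lemma IsC1Representative.boundaryValue_eq {ψ : GraphL2 E a} {f g : E ⊕ I → ℝ → ℂ}
    (hf : IsC1Representative ψ f) (hg : IsC1Representative ψ g) :
    boundaryValue a f = boundaryValue a g := by
  ext (e | i | i)
  · exact hf.eqOn hg _ (zero_mem_edge a _)
  · exact hf.eqOn hg _ (zero_mem_edge a _)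
  · exact hf.eqOn hg _ (len_mem_edge a i)

lemma IsC1Representative.boundaryDeriv_eq {ψ : GraphL2 E a} {f g : E ⊕ I → ℝ → ℂ}
    (hf : IsC1Representative ψ f) (hg : IsC1Representative ψ g) :
    boundaryDeriv a f = boundaryDeriv a g := by
  have key : ∀ (j : E ⊕ I), ∀ x ∈ edge a j, derivWithin (f j) (edge a j) x =
      derivWithin (g j) (edge a j) x := fun j x hx =>
    derivWithin_congr (hf.eqOn hg j) (hf.eqOn hg j hx)
  ext (e | i | i)
  · exact key _ _ (zero_mem_edge a _)
  · exact key _ _ (zero_mem_edge a _)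
  · exact congrArg Neg.neg (key _ _ (len_mem_edge a i))

lemma exists_isC1Representative (p : maximalGraph 𝒜) : ∃ f, IsC1Representative p.1.1 f := by
  obtain ⟨F, K, h⟩ := exists_isRegularRepresentative p.2
  exact ⟨F, h.isC1Representative⟩

lemma inner_graphL2 (ψ φ : GraphL2 E a) :
    inner ℂ ψ φ = ∑ j, ∫ x in openEdge a j, starRingEnd ℂ (ψ j x) * φ j x := by
  rw [PiLp.inner_apply]
  refine Finset.sum_congr rfl fun j _ => ?_
  rw [L2.inner_def]
  refine integral_congr_ae (Filter.Eventually.of_forall fun x => ?_)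
  simp only [RCLike.inner_apply]
  ring

variable [DecidableEq E] [DecidableEq I]

lemma boundaryMagneticDeriv_add {ψ φ : GraphL2 E a} {f g : E ⊕ I → ℝ → ℂ}
    (hf : IsC1Representative ψ f) (hg : IsC1Representative φ g) :
    boundaryMagneticDeriv 𝒜 (f + g) = boundaryMagneticDeriv 𝒜 f + boundaryMagneticDeriv 𝒜 g := by
  simp only [boundaryMagneticDeriv, boundaryValue_add, boundaryDeriv_add hf hg,
    Matrix.mulVec_add, smul_add]
  abel

lemma boundaryMagneticDeriv_smul (c : ℂ) (f : E ⊕ I → ℝ → ℂ) :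
    boundaryMagneticDeriv 𝒜 (c • f) = c • boundaryMagneticDeriv 𝒜 f := by
  simp only [boundaryMagneticDeriv, boundaryValue_smul, boundaryDeriv_smul,
    Matrix.mulVec_smul, smul_sub]
  rw [smul_comm c Complex.I]

lemma IsC1Representative.boundaryMagneticDeriv_eq {ψ : GraphL2 E a} {f g : E ⊕ I → ℝ → ℂ}
    (hf : IsC1Representative ψ f) (hg : IsC1Representative ψ g) :
    boundaryMagneticDeriv 𝒜 f = boundaryMagneticDeriv 𝒜 g := by
  rw [boundaryMagneticDeriv, boundaryMagneticDeriv, hf.boundaryValue_eq hg, hf.boundaryDeriv_eq hg]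

/-- The boundary map of the maximal operator: it sends a function, given as an element of the
maximal graph, to its boundary values and its magnetic boundary derivatives. It is defined through
a choice of a continuously differentiable representative, on which it does not depend. -/
noncomputable def boundaryMap (𝒜 : VectorPotential E a) :
    maximalGraph 𝒜 →ₗ[ℂ] (Ends E I → ℂ) × (Ends E I → ℂ) where
  toFun p := (boundaryValue a (exists_isC1Representative p).choose,
    boundaryMagneticDeriv 𝒜 (exists_isC1Representative p).choose)
  map_add' p q := by
    have hp := (exists_isC1Representative p).choose_spec
    have hq := (exists_isC1Representative q).choose_spec
    have hpq : IsC1Representative (p + q).1.1 _ := (exists_isC1Representative (p + q)).choose_spec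
    rw [hpq.boundaryValue_eq (hp.add hq), hpq.boundaryMagneticDeriv_eq (hp.add hq),
      boundaryValue_add, boundaryMagneticDeriv_add hp hq]
    rfl
  map_smul' c p := by
    have hp := (exists_isC1Representative p).choose_spec
    have hcp : IsC1Representative (c • p).1.1 _ := (exists_isC1Representative (c • p)).choose_spec
    rw [hcp.boundaryValue_eq (hp.const_smul c), hcp.boundaryMagneticDeriv_eq (hp.const_smul c),
      boundaryValue_smul, boundaryMagneticDeriv_smul]
    rfl

lemma boundaryMap_eq {p : maximalGraph 𝒜} {f : E ⊕ I → ℝ → ℂ} (hf : IsC1Representative p.1.1 f) :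
    boundaryMap 𝒜 p = (boundaryValue a f, boundaryMagneticDeriv 𝒜 f) := by
  have hp := (exists_isC1Representative p).choose_spec
  rw [← hp.boundaryValue_eq hf, ← hp.boundaryMagneticDeriv_eq hf]
  rfl

lemma IsRegularRepresentative.boundaryMap_eq {p : maximalGraph 𝒜}
    (h : IsRegularRepresentative 𝒜 p.1 F K) :
    boundaryMap 𝒜 p = (boundaryValue a F, inwardValue a K) := by
  rw [MagneticGraph.boundaryMap_eq h.isC1Representative, h.boundaryMagneticDeriv_eq]

lemma mem_boundaryCondition_iff {A B : Matrix (Ends E I) (Ends E I) ℂ} (p : maximalGraph 𝒜) :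
    p.1.1 ∈ boundaryCondition 𝒜 A B ↔ A *ᵥ (boundaryMap 𝒜 p).1 + B *ᵥ (boundaryMap 𝒜 p).2 = 0 := by
  constructor
  · rintro ⟨f, hf, h⟩
    rw [boundaryMap_eq hf]
    exact h
  · intro h
    obtain ⟨f, hf⟩ := exists_isC1Representative p
    rw [boundaryMap_eq hf] at h
    exact ⟨f, hf, h⟩

lemma mem_vanishingBoundary_iff (p : maximalGraph 𝒜) :
    p.1.1 ∈ vanishingBoundary E a ↔ boundaryMap 𝒜 p = 0 := by
  constructor
  · rintro ⟨f, hf, h, h'⟩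
    rw [boundaryMap_eq hf, boundaryMagneticDeriv, h, h']
    simp
  · intro h
    obtain ⟨f, hf⟩ := exists_isC1Representative p
    rw [boundaryMap_eq hf, Prod.mk_eq_zero, boundaryMagneticDeriv] at h
    refine ⟨f, hf, h.1, ?_⟩
    simpa [h.1] using h.2

/-- **Green's identity** on the graph. -/
lemma inner_sub_inner_eq (p q : maximalGraph 𝒜) :
    inner ℂ p.1.2 q.1.1 - inner ℂ p.1.1 q.1.2 =
      star (boundaryMap 𝒜 p).1 ⬝ᵥ (boundaryMap 𝒜 q).2 -
        star (boundaryMap 𝒜 p).2 ⬝ᵥ (boundaryMap 𝒜 q).1 := by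
  obtain ⟨F, K, h⟩ := exists_isRegularRepresentative p.2
  obtain ⟨F', K', h'⟩ := exists_isRegularRepresentative q.2
  rw [h.boundaryMap_eq, h'.boundaryMap_eq, inner_graphL2, inner_graphL2, ← Finset.sum_sub_distrib]
  have key : ∀ j, (∫ x in openEdge a j, starRingEnd ℂ (p.1.2 j x) * q.1.1 j x) -
      (∫ x in openEdge a j, starRingEnd ℂ (p.1.1 j x) * q.1.2 j x) =
      endValue a j (fun x => starRingEnd ℂ (K j x) * F' j x - starRingEnd ℂ (F j x) * K' j x) -
        (starRingEnd ℂ (K j 0) * F' j 0 - starRingEnd ℂ (F j 0) * K' j 0) := by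
    intro j
    rw [← integral_green (h.primitive j) (h.deriv_primitive j) (h'.primitive j)
      (h'.deriv_primitive j)
      ((Lp.memLp _).ae_eq (h.ae_eq j).symm) (h.memLp j) (Lp.memLp _)
      ((Lp.memLp _).ae_eq (h'.ae_eq j).symm) (h'.memLp j) (Lp.memLp _)]
    congr 1
    · refine integral_congr_ae ?_
      filter_upwards [h'.ae_eq j] with x hx
      rw [hx]
    · refine integral_congr_ae ?_
      filter_upwards [h.ae_eq j] with x hx
      rw [hx]
  simp only [key, dotProduct, Fintype.sum_sum_type, ← Finset.sum_add_distrib,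
    Pi.star_apply, RCLike.star_def, endValue, boundaryValue,
    inwardValue, map_neg]
  simp only [Finset.sum_add_distrib, Finset.sum_sub_distrib, Finset.sum_neg_distrib, neg_mul,
    mul_neg, zero_sub]
  ring

/-! ### Surjectivity of the boundary map, and the adjoint of the minimal operator -/

/-- Smooth compactly supported functions on the edges, multiplied by the gauge factors, belong to
the maximal domain. -/
lemma exists_maximalGraph_of_contDiff (𝒜 : VectorPotential E a) {h : E ⊕ I → ℝ → ℂ}
    (hs : ∀ j, ContDiff ℝ ∞ (h j)) (hc : ∀ j, HasCompactSupport (h j)) :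
    ∃ p : maximalGraph 𝒜,
      (∀ j, p.1.1 j =ᵐ[edgeMeasure a j] fun x => gauge 𝒜 j x * h j x) ∧
      (∀ j, p.1.2 j =ᵐ[edgeMeasure a j] fun x => gauge 𝒜 j x * deriv (deriv (h j)) x) ∧
      boundaryMap 𝒜 p = (boundaryValue a fun j x => gauge 𝒜 j x * h j x,
        inwardValue a fun j x => gauge 𝒜 j x * deriv (h j) x) := by
  have hs' : ∀ j, ContDiff ℝ ∞ (deriv (h j)) := fun j => (contDiff_infty_iff_deriv.1 (hs j)).2
  have hs'' : ∀ j, ContDiff ℝ ∞ (deriv (deriv (h j))) := fun j =>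
    (contDiff_infty_iff_deriv.1 (hs' j)).2
  have hm : ∀ (j : E ⊕ I) {u : ℝ → ℂ}, ContDiff ℝ ∞ u → HasCompactSupport u →
      MemLp (fun x => gauge 𝒜 j x * u x) 2 (edgeMeasure a j) := fun j u hu hu' =>
    memLp_unimodular_mul continuous_gauge norm_gauge
      ((hu.continuous.memLp_of_hasCompactSupport hu' (μ := volume)).restrict _)
  have hprim : ∀ (j : E ⊕ I) {u : ℝ → ℂ}, ContDiff ℝ ∞ u → IsMagneticPrimitive 𝒜 j
      (fun x => gauge 𝒜 j x * u x) (fun x => gauge 𝒜 j x * deriv u x) := fun j u hu =>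
    IsEdgePrimitive.gauge_mul fun b hb => IsPrimitive.of_hasDerivAt (nonneg_of_mem_edge hb)
      (fun x => ((contDiff_infty_iff_deriv.1 hu).1 x).hasDerivAt)
      (contDiff_infty_iff_deriv.1 hu).2.continuous
  have m0 := fun j => hm j (hs j) (hc j)
  have m1 := fun j => hm j (hs' j) (hc j).deriv
  have m2 := fun j => hm j (hs'' j) (hc j).deriv.deriv
  let p : GraphL2 E a × GraphL2 E a :=
    (WithLp.toLp 2 fun j => (m0 j).toLp, WithLp.toLp 2 fun j => (m2 j).toLp)
  have hrep : IsRegularRepresentative 𝒜 p (fun j x => gauge 𝒜 j x * h j x)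
      (fun j x => gauge 𝒜 j x * deriv (h j) x) :=
    ⟨fun j => (m0 j).coeFn_toLp.symm, fun j => hprim j (hs j),
      fun j => (hprim j (hs' j)).congr (fun _ _ => rfl) (m2 j).coeFn_toLp.symm, m1⟩
  refine ⟨⟨p, hrep.mem_maximalGraph⟩, fun j => (m0 j).coeFn_toLp, fun j => (m2 j).coeFn_toLp, ?_⟩
  exact IsRegularRepresentative.boundaryMap_eq (p := ⟨p, hrep.mem_maximalGraph⟩) hrep

/-- A smooth compactly supported function with prescribed values and derivatives at two points. -/
lemma exists_contDiff_interpolation {s t : ℝ} (hst : s ≠ t) (α β γ δ : ℂ) :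
    ∃ h : ℝ → ℂ, ContDiff ℝ ∞ h ∧ HasCompactSupport h ∧
      h s = α ∧ deriv h s = β ∧ h t = γ ∧ deriv h t = δ := by
  -- It suffices to treat data that vanish at one of the two points.
  have key : ∀ {s t : ℝ}, s ≠ t → ∀ α β : ℂ, ∃ h : ℝ → ℂ, ContDiff ℝ ∞ h ∧
      HasCompactSupport h ∧ h s = α ∧ deriv h s = β ∧ h t = 0 ∧ deriv h t = 0 := by
    intro s t hst α β
    have hd : 0 < dist t s := dist_pos.2 hst.symm
    let b : ContDiffBump s := ⟨dist t s / 4, dist t s / 2, by linarith, by linarith⟩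
    have hb0 : (b : ℝ → ℝ) =ᶠ[nhds t] 0 := by
      refine notMem_tsupport_iff_eventuallyEq.1 ?_
      rw [b.tsupport_eq, Metric.mem_closedBall, not_le]
      change dist t s / 2 < dist t s
      linarith
    have hl : ∀ x, HasDerivAt (fun x : ℝ => α + β * ((x - s : ℝ) : ℂ)) β x := fun x => by
      simpa using ((((hasDerivAt_id x).sub_const s).ofReal_comp).const_mul β).const_add α
    have e1 : (fun x => ((b x : ℝ) : ℂ) * (α + β * ((x - s : ℝ) : ℂ))) =ᶠ[nhds s]
        fun x => α + β * ((x - s : ℝ) : ℂ) := by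
      filter_upwards [b.eventuallyEq_one] with x hx
      simp [hx]
    have e2 : (fun x => ((b x : ℝ) : ℂ) * (α + β * ((x - s : ℝ) : ℂ))) =ᶠ[nhds t]
        fun _ => 0 := by
      filter_upwards [hb0] with x hx
      simp [hx]
    refine ⟨fun x => ((b x : ℝ) : ℂ) * (α + β * ((x - s : ℝ) : ℂ)), ?_, ?_, ?_, ?_, ?_, ?_⟩
    · exact (Complex.ofRealCLM.contDiff.comp b.contDiff).mul
        (contDiff_const.add (contDiff_const.mul
          (Complex.ofRealCLM.contDiff.comp (contDiff_id.sub contDiff_const))))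
    · exact (b.hasCompactSupport.comp_left Complex.ofReal_zero).mul_right
    · refine e1.eq_of_nhds.trans ?_
      simp
    · rw [e1.deriv_eq, (hl s).deriv]
    · exact e2.eq_of_nhds
    · rw [e2.deriv_eq, deriv_const]
  obtain ⟨f, f1, f2, f3, f4, f5, f6⟩ := key hst α β
  obtain ⟨g, g1, g2, g3, g4, g5, g6⟩ := key hst.symm γ δ
  have hd : ∀ x, deriv (f + g) x = deriv f x + deriv g x := fun x =>
    deriv_add ((contDiff_infty_iff_deriv.1 f1).1 x) ((contDiff_infty_iff_deriv.1 g1).1 x)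
  refine ⟨f + g, f1.add g1, f2.add g2, ?_, ?_, ?_, ?_⟩
  · rw [Pi.add_apply, f3, g5, add_zero]
  · rw [hd, f4, g6, add_zero]
  · rw [Pi.add_apply, f5, g3, zero_add]
  · rw [hd, f6, g4, zero_add]

lemma boundaryMap_surjective (𝒜 : VectorPotential E a) : Function.Surjective (boundaryMap 𝒜) := by
  rintro ⟨x, y⟩
  have hex : ∀ j : E ⊕ I, ∃ h : ℝ → ℂ, ContDiff ℝ ∞ h ∧ HasCompactSupport h ∧
      match j with
      | Sum.inl e => h 0 = x (Sum.inl e) ∧ deriv h 0 = y (Sum.inl e)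
      | Sum.inr i => h 0 = x (Sum.inr (Sum.inl i)) ∧ deriv h 0 = y (Sum.inr (Sum.inl i)) ∧
          gauge 𝒜 (Sum.inr i) (a.len i) * h (a.len i) = x (Sum.inr (Sum.inr i)) ∧
          gauge 𝒜 (Sum.inr i) (a.len i) * deriv h (a.len i) = -y (Sum.inr (Sum.inr i)) := by
    rintro (e | i)
    · obtain ⟨h, h1, h2, h3, h4, -⟩ := exists_contDiff_interpolation (zero_ne_one (α := ℝ))
        (x (Sum.inl e)) (y (Sum.inl e)) 0 0
      exact ⟨h, h1, h2, h3, h4⟩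
    · obtain ⟨h, h1, h2, h3, h4, h5, h6⟩ := exists_contDiff_interpolation (a.pos i).ne
        (x (Sum.inr (Sum.inl i))) (y (Sum.inr (Sum.inl i)))
        ((gauge 𝒜 (Sum.inr i) (a.len i))⁻¹ * x (Sum.inr (Sum.inr i)))
        ((gauge 𝒜 (Sum.inr i) (a.len i))⁻¹ * -y (Sum.inr (Sum.inr i)))
      refine ⟨h, h1, h2, h3, h4, ?_, ?_⟩
      · rw [h5, mul_inv_cancel_left₀ (gauge_ne_zero _)]
      · rw [h6, mul_inv_cancel_left₀ (gauge_ne_zero _)]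
  choose h hs hc hv using hex
  obtain ⟨p, -, -, hp⟩ := exists_maximalGraph_of_contDiff 𝒜 hs hc
  refine ⟨p, hp.trans (Prod.ext ?_ ?_)⟩
  · ext (e | i | i)
    · simp only [boundaryValue, gauge_zero, one_mul, (hv (Sum.inl e)).1]
    · simp only [boundaryValue, gauge_zero, one_mul, (hv (Sum.inr i)).1]
    · exact (hv (Sum.inr i)).2.2.1
  · ext (e | i | i)
    · simp only [inwardValue, gauge_zero, one_mul, (hv (Sum.inl e)).2]
    · simp only [inwardValue, gauge_zero, one_mul, (hv (Sum.inr i)).2.1]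
    · simp only [inwardValue, (hv (Sum.inr i)).2.2.2, neg_neg]

/-- The part of the maximal graph whose boundary data lie in `M`. -/
noncomputable def restrictedGraph (𝒜 : VectorPotential E a)
    (M : Submodule ℂ ((Ends E I → ℂ) × (Ends E I → ℂ))) :
    Submodule ℂ (GraphL2 E a × GraphL2 E a) :=
  (M.comap (boundaryMap 𝒜)).map (maximalGraph 𝒜).subtype

lemma mem_restrictedGraph {M : Submodule ℂ ((Ends E I → ℂ) × (Ends E I → ℂ))}
    {p : GraphL2 E a × GraphL2 E a} :
    p ∈ restrictedGraph 𝒜 M ↔ ∃ hp : p ∈ maximalGraph 𝒜, boundaryMap 𝒜 ⟨p, hp⟩ ∈ M := by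
  simp [restrictedGraph]

/-- The adjoint of the minimal operator is contained in the maximal operator. -/
lemma adjoint_restrictedGraph_bot_le :
    (restrictedGraph 𝒜 ⊥).adjoint ≤ maximalGraph 𝒜 := by
  rintro ⟨ψ, φ⟩ h
  rw [Submodule.mem_adjoint_iff] at h
  have key : ∀ j, ∃ K, MemLp K 2 (edgeMeasure a j) ∧ IsWeakMagneticDeriv 𝒜 j (ψ j) K ∧
      IsWeakMagneticDeriv 𝒜 j K (φ j) := by
    intro j
    refine exists_isWeakMagneticDeriv_of_forall_test (Lp.memLp _) (Lp.memLp _) fun η hη => ?_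
    -- Test the adjoint against the gauge transform of `η`, placed on the edge `j`.
    set u : E ⊕ I → ℝ → ℂ := Pi.single j fun x => (η x : ℂ)
    have uj : u j = fun x => (η x : ℂ) := Pi.single_eq_same _ _
    have un : ∀ k, k ≠ j → u k = 0 := fun k hk => Pi.single_eq_of_ne hk _
    have d1 : deriv (fun x => (η x : ℂ)) = fun x => ((deriv η x : ℝ) : ℂ) :=
      funext fun x => (hη.hasDerivAt x).ofReal_comp.deriv
    have d2 : deriv (fun x => ((deriv η x : ℝ) : ℂ)) = fun x => ((deriv (deriv η) x : ℝ) : ℂ) :=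
      funext fun x => (hη.deriv.hasDerivAt x).ofReal_comp.deriv
    have z0 : ∀ k x, x ∉ openEdge a k → u k x = 0 := by
      intro k x hx
      rcases eq_or_ne k j with rfl | hk
      · simp only [uj, hη.eq_zero hx, Complex.ofReal_zero]
      · rw [un k hk, Pi.zero_apply]
    have z1 : ∀ k x, x ∉ openEdge a k → deriv (u k) x = 0 := by
      intro k x hx
      rcases eq_or_ne k j with rfl | hk
      · simp only [uj, d1, hη.deriv.eq_zero hx, Complex.ofReal_zero]
      · rw [un k hk, deriv_zero, Pi.zero_apply]
    obtain ⟨p, hp1, hp2, hp3⟩ := exists_maximalGraph_of_contDiff 𝒜 (h := u)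
      (fun k => by
        rcases eq_or_ne k j with rfl | hk
        · rw [uj]; exact Complex.ofRealCLM.contDiff.comp hη.contDiff
        · rw [un k hk]; exact contDiff_const)
      (fun k => by
        rcases eq_or_ne k j with rfl | hk
        · rw [uj]; exact hη.hasCompactSupport.comp_left Complex.ofReal_zero
        · rw [un k hk]; exact HasCompactSupport.zero)
    have hlen : ∀ i, a.len i ∉ openEdge a (Sum.inr i : E ⊕ I) := fun i hi => lt_irrefl _ hi.2
    have hp0 : boundaryMap 𝒜 p = 0 := by
      rw [hp3]
      refine Prod.ext ?_ ?_
      · ext (e | i | i)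
        · simp [boundaryValue, z0 _ _ zero_notMem_openEdge]
        · simp [boundaryValue, z0 _ _ zero_notMem_openEdge]
        · simp [boundaryValue, z0 _ _ (hlen i)]
      · ext (e | i | i)
        · simp [inwardValue, z1 _ _ zero_notMem_openEdge]
        · simp [inwardValue, z1 _ _ zero_notMem_openEdge]
        · simp [inwardValue, z1 _ _ (hlen i)]
    have e := h p.1.1 p.1.2 (mem_restrictedGraph.2 ⟨p.2, (Submodule.mem_bot ℂ).2 hp0⟩)
    rw [sub_eq_zero, inner_graphL2, inner_graphL2, Finset.sum_eq_single j, Finset.sum_eq_single j]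
      at e
    · have e1 : ∫ x in openEdge a j, starRingEnd ℂ (p.1.2 j x) * ψ j x =
          ∫ x in openEdge a j,
            starRingEnd ℂ (gauge 𝒜 j x * ((deriv (deriv η) x : ℝ) : ℂ)) * ψ j x := by
        refine integral_congr_ae ?_
        filter_upwards [hp2 j] with x hx
        rw [hx, uj, d1, d2]
      have e2 : ∫ x in openEdge a j, starRingEnd ℂ (p.1.1 j x) * φ j x =
          ∫ x in openEdge a j, starRingEnd ℂ (gauge 𝒜 j x * (η x : ℂ)) * φ j x := by
        refine integral_congr_ae ?_
        filter_upwards [hp1 j] with x hx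
        rw [hx, uj]
      rw [← e1, ← e2]
      exact e
    · intro k _ hk
      refine integral_eq_zero_of_ae ?_
      filter_upwards [hp1 k] with x hx
      rw [hx, un k hk]
      simp
    · simp
    · intro k _ hk
      refine integral_eq_zero_of_ae ?_
      filter_upwards [hp2 k] with x hx
      rw [hx, un k hk]
      simp
    · simp
  choose K hK hK1 hK2 using key
  refine ⟨WithLp.toLp 2 fun j => (hK j).toLp, fun j => ⟨?_, ?_⟩⟩
  · exact (hK1 j).congr Filter.EventuallyEq.rfl (hK j).coeFn_toLp.symm
  · exact (hK2 j).congr (hK j).coeFn_toLp.symm Filter.EventuallyEq.rfl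

end BoundaryMap

/-! ### Lagrangian subspaces of the space of boundary data -/

section Lagrangian

variable {n κ : Type*} [Fintype n]

/-- The orthogonal complement with respect to the Hermitian symplectic form
`(x, y), (x', y') ↦ ⟨x, y'⟩ - ⟨y, x'⟩`. -/
def symplecticComplement (M : Submodule ℂ ((n → ℂ) × (n → ℂ))) :
    Submodule ℂ ((n → ℂ) × (n → ℂ)) where
  carrier := {z | ∀ w ∈ M, star w.1 ⬝ᵥ z.2 - star w.2 ⬝ᵥ z.1 = 0}
  zero_mem' w _ := by simp
  add_mem' {z z'} hz hz' w hw := by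
    have h1 := hz w hw
    have h2 := hz' w hw
    simp only [Prod.fst_add, Prod.snd_add, dotProduct_add]
    linear_combination h1 + h2
  smul_mem' c z hz w hw := by
    have h1 := hz w hw
    simp only [Prod.smul_fst, Prod.smul_snd, dotProduct_smul, smul_eq_mul]
    linear_combination c * h1

/-- The boundary data `(x, y)` with `A x + B y = 0`. -/
def boundaryKernel (A B : Matrix κ n ℂ) : Submodule ℂ ((n → ℂ) × (n → ℂ)) :=
  LinearMap.ker (A.mulVecLin.coprod B.mulVecLin)

/-- The boundary data of the form `(-Bᴴ c, Aᴴ c)`. -/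
def boundaryRange [Fintype κ] (A B : Matrix κ n ℂ) : Submodule ℂ ((n → ℂ) × (n → ℂ)) :=
  LinearMap.range ((-Bᴴ.mulVecLin).prod Aᴴ.mulVecLin)

variable {A B : Matrix κ n ℂ}

lemma mem_boundaryKernel {z : (n → ℂ) × (n → ℂ)} :
    z ∈ boundaryKernel A B ↔ A *ᵥ z.1 + B *ᵥ z.2 = 0 := by
  simp [boundaryKernel]

lemma symplecticComplement_boundaryKernel [Fintype κ] :
    symplecticComplement (boundaryKernel A B) = boundaryRange A B := by
  classical
  ext z
  constructor
  · intro hz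
    -- The functional `w ↦ ⟨z.2, w.1⟩ - ⟨z.1, w.2⟩` vanishes on the kernel of `(A, B)`, hence
    -- factors through `(A, B)`.
    let l : Module.Dual ℂ ((n → ℂ) × (n → ℂ)) :=
      (dotProductBilin ℂ ℂ (star z.2)).coprod (-(dotProductBilin ℂ ℂ (star z.1)))
    have hl : ∀ w, l w = star z.2 ⬝ᵥ w.1 - star z.1 ⬝ᵥ w.2 := fun w => by
      simp [l, dotProductBilin, sub_eq_add_neg]
    have hmem : l ∈ (LinearMap.ker (A.mulVecLin.coprod B.mulVecLin)).dualAnnihilator := by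
      rw [Submodule.mem_dualAnnihilator]
      intro w hw
      have h := congrArg star (hz w hw)
      rwa [star_sub, star_zero, ← Matrix.star_dotProduct, ← Matrix.star_dotProduct, ← hl] at h
    rw [← LinearMap.range_dualMap_eq_dualAnnihilator_ker] at hmem
    obtain ⟨φ, hφ⟩ := hmem
    let c : κ → ℂ := star fun k => φ fun i => if k = i then 1 else 0
    have hc : ∀ v, φ v = star c ⬝ᵥ v := fun v => by
      rw [LinearMap.pi_apply_eq_sum_univ φ v, star_star]
      exact Finset.sum_congr rfl fun k _ => mul_comm _ _
    have hw : ∀ w : (n → ℂ) × (n → ℂ), star (Aᴴ *ᵥ c) ⬝ᵥ w.1 + star (Bᴴ *ᵥ c) ⬝ᵥ w.2 =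
        star z.2 ⬝ᵥ w.1 - star z.1 ⬝ᵥ w.2 := fun w => by
      rw [← hl, ← hφ, LinearMap.dualMap_apply, hc, LinearMap.coprod_apply, dotProduct_add,
        Matrix.mulVecLin_apply, Matrix.mulVecLin_apply, Matrix.dotProduct_mulVec,
        Matrix.dotProduct_mulVec, Matrix.star_mulVec, Matrix.star_mulVec,
        Matrix.conjTranspose_conjTranspose, Matrix.conjTranspose_conjTranspose]
    have h2 : star (Aᴴ *ᵥ c) = star z.2 := dotProduct_eq _ _ fun u => by simpa using hw (u, 0)
    have h1 : star (Bᴴ *ᵥ c) = -star z.1 := dotProduct_eq _ _ fun u => by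
      simpa using hw (0, u)
    refine ⟨c, Prod.ext ?_ (star_injective h2)⟩
    change -(Bᴴ *ᵥ c) = z.1
    rw [← star_neg] at h1
    rw [star_injective h1, neg_neg]
  · rintro ⟨c, rfl⟩ w hw
    rw [mem_boundaryKernel] at hw
    have h := congrArg (fun v => star v ⬝ᵥ c) hw
    simp only [star_add, Matrix.star_mulVec, add_dotProduct, star_zero, zero_dotProduct,
      ← Matrix.dotProduct_mulVec] at h
    change star w.1 ⬝ᵥ (Aᴴ *ᵥ c) - star w.2 ⬝ᵥ (-(Bᴴ *ᵥ c)) = 0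
    rw [dotProduct_neg, sub_neg_eq_add, h]

open scoped ComplexOrder in
lemma finrank_boundaryRange [Fintype κ] :
    Module.finrank ℂ (boundaryRange A B) = (Matrix.fromCols A B).rank := by
  have hker : LinearMap.ker ((-Bᴴ.mulVecLin).prod Aᴴ.mulVecLin) =
      LinearMap.ker (Matrix.fromCols A B)ᴴ.mulVecLin := by
    ext c
    rw [LinearMap.ker_prod, Submodule.mem_inf, LinearMap.mem_ker, LinearMap.mem_ker,
      LinearMap.mem_ker, LinearMap.neg_apply, neg_eq_zero, Matrix.mulVecLin_apply,
      Matrix.mulVecLin_apply, Matrix.mulVecLin_apply,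
      Matrix.conjTranspose_fromCols_eq_fromRows_conjTranspose, Matrix.fromRows_mulVec]
    constructor
    · rintro ⟨h1, h2⟩
      rw [h1, h2, Sum.elim_zero_zero]
    · intro h
      exact ⟨funext fun i => congrFun h (Sum.inr i), funext fun i => congrFun h (Sum.inl i)⟩
  have h1 := LinearMap.finrank_range_add_finrank_ker ((-Bᴴ.mulVecLin).prod Aᴴ.mulVecLin)
  have h2 := LinearMap.finrank_range_add_finrank_ker (Matrix.fromCols A B)ᴴ.mulVecLin
  rw [← Matrix.rank_conjTranspose, Matrix.rank, boundaryRange]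
  rw [hker] at h1
  omega

lemma finrank_boundaryKernel :
    (Matrix.fromCols A B).rank + Module.finrank ℂ (boundaryKernel A B) = 2 * Fintype.card n := by
  have hr : LinearMap.range (A.mulVecLin.coprod B.mulVecLin) =
      LinearMap.range (Matrix.fromCols A B).mulVecLin := by
    ext v
    constructor
    · rintro ⟨w, rfl⟩
      exact ⟨Sum.elim w.1 w.2, by simp⟩
    · rintro ⟨w, rfl⟩
      refine ⟨(w ∘ Sum.inl, w ∘ Sum.inr), ?_⟩
      simp [Matrix.fromCols_mulVec]
  have h1 := LinearMap.finrank_range_add_finrank_ker (A.mulVecLin.coprod B.mulVecLin)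
  rw [hr, Module.finrank_prod, Module.finrank_fintype_fun_eq_card] at h1
  rw [Matrix.rank, boundaryKernel, h1]
  ring

/-- The kernel of `(A, B)` is Lagrangian precisely if `A Bᴴ` is Hermitian and `(A, B)` has full
rank. -/
lemma symplecticComplement_boundaryKernel_eq_self_iff {A B : Matrix n n ℂ} :
    symplecticComplement (boundaryKernel A B) = boundaryKernel A B ↔
      A * Bᴴ - B * Aᴴ = 0 ∧ (Matrix.fromCols A B).rank = Fintype.card n := by
  have hle : boundaryRange A B ≤ boundaryKernel A B ↔ A * Bᴴ - B * Aᴴ = 0 := by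
    have e : ∀ c : n → ℂ, A *ᵥ (-(Bᴴ *ᵥ c)) + B *ᵥ (Aᴴ *ᵥ c) = -((A * Bᴴ - B * Aᴴ) *ᵥ c) := by
      intro c
      rw [Matrix.sub_mulVec, Matrix.mulVec_neg, Matrix.mulVec_mulVec, Matrix.mulVec_mulVec]
      abel
    constructor
    · intro h
      classical
      refine Matrix.ext_of_mulVec_single fun i => ?_
      have h' := mem_boundaryKernel.1 (h ⟨Pi.single i 1, rfl⟩)
      rw [Matrix.zero_mulVec, ← neg_eq_zero, ← e]
      exact h'
    · rintro h _ ⟨c, rfl⟩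
      rw [mem_boundaryKernel]
      refine (e c).trans ?_
      rw [h, Matrix.zero_mulVec, neg_zero]
  have h1 := finrank_boundaryRange (A := A) (B := B)
  have h2 := finrank_boundaryKernel (A := A) (B := B)
  rw [symplecticComplement_boundaryKernel]
  constructor
  · intro h
    refine ⟨hle.1 h.le, ?_⟩
    rw [h] at h1
    omega
  · rintro ⟨h, hr⟩
    refine Submodule.eq_of_le_of_finrank_eq (hle.2 h) ?_
    omega

/-- Every linear map out of the space of boundary data is of the form `(A, B)`. -/
lemma exists_ker_eq_boundaryKernel (T : ((n → ℂ) × (n → ℂ)) →ₗ[ℂ] (κ → ℂ)) :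
    ∃ A B : Matrix κ n ℂ, LinearMap.ker T = boundaryKernel A B := by
  classical
  refine ⟨LinearMap.toMatrix' (T ∘ₗ LinearMap.inl ℂ _ _),
    LinearMap.toMatrix' (T ∘ₗ LinearMap.inr ℂ _ _), ?_⟩
  rw [boundaryKernel, ← Matrix.toLin'_apply', ← Matrix.toLin'_apply', Matrix.toLin'_toMatrix',
    Matrix.toLin'_toMatrix', ← LinearMap.comp_coprod, LinearMap.coprod_inl_inr, LinearMap.comp_id]

/-- Every Lagrangian subspace is the kernel of some `(A, B)` with square matrices `A` and `B`. -/
lemma exists_eq_boundaryKernel {M : Submodule ℂ ((n → ℂ) × (n → ℂ))}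
    (hM : symplecticComplement M = M) : ∃ A B : Matrix n n ℂ, M = boundaryKernel A B := by
  have hq := M.finrank_quotient_add_finrank
  rw [Module.finrank_prod, Module.finrank_fintype_fun_eq_card] at hq
  -- For the kernel of any `(A, B)` the dimensions of the space and of its complement add up to twice
  -- the cardinality of `n`.
  have hN : Module.finrank ℂ M = Fintype.card n := by
    obtain ⟨A, B, h⟩ := exists_ker_eq_boundaryKernel
      ((Module.finBasis ℂ (((n → ℂ) × (n → ℂ)) ⧸ M)).equivFun.toLinearMap ∘ₗ M.mkQ)
    rw [LinearEquiv.ker_comp, Submodule.ker_mkQ] at h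
    have h1 := finrank_boundaryRange (A := A) (B := B)
    have h2 := finrank_boundaryKernel (A := A) (B := B)
    rw [← symplecticComplement_boundaryKernel, ← h, hM] at h1
    rw [← h] at h2
    omega
  let e : (((n → ℂ) × (n → ℂ)) ⧸ M) ≃ₗ[ℂ] (n → ℂ) := LinearEquiv.ofFinrankEq _ _ (by
    rw [Module.finrank_fintype_fun_eq_card]; omega)
  obtain ⟨A, B, h⟩ := exists_ker_eq_boundaryKernel (e.toLinearMap ∘ₗ M.mkQ)
  rw [LinearEquiv.ker_comp, Submodule.ker_mkQ] at h
  exact ⟨A, B, h⟩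

end Lagrangian

/-! ### Extensions of the minimal operator -/

section Graphs

variable {H : Type*} [NormedAddCommGroup H] [InnerProductSpace ℂ H]

lemma adjoint_anti {g g' : Submodule ℂ (H × H)} (h : g ≤ g') :
    g'.adjoint ≤ g.adjoint := by
  intro x hx
  rw [Submodule.mem_adjoint_iff] at hx ⊢
  exact fun b c hbc => hx b c (h hbc)

lemma mem_graph_domRestrict {f : H →ₗ.[ℂ] H} {S : Submodule ℂ H} {p : H × H} :
    p ∈ (f.domRestrict S).graph ↔ p ∈ f.graph ∧ p.1 ∈ S := by
  constructor
  · intro h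
    refine ⟨LinearPMap.le_graph_of_le LinearPMap.domRestrict_le h, ?_⟩
    exact (LinearPMap.mem_domain_of_mem_graph (y := p.2) h).1
  · rintro ⟨h, hS⟩
    obtain ⟨y, hy, hy'⟩ := (LinearPMap.mem_graph_iff f).1 h
    rw [LinearPMap.mem_graph_iff]
    have hmem : p.1 ∈ (f.domRestrict S).domain := ⟨hS, hy ▸ y.2⟩
    exact ⟨⟨p.1, hmem⟩, rfl, (LinearPMap.domRestrict_apply hy.symm).trans hy'⟩

end Graphs

section Extensions

variable {E I : Type*} [Fintype E] [Fintype I] [DecidableEq E] [DecidableEq I] {a : EdgeLengths I}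
  {𝒜 : VectorPotential E a}

lemma restrictedGraph_le_iff {M N : Submodule ℂ ((Ends E I → ℂ) × (Ends E I → ℂ))} :
    restrictedGraph 𝒜 M ≤ restrictedGraph 𝒜 N ↔ M ≤ N := by
  constructor
  · intro h z hz
    obtain ⟨p, rfl⟩ := boundaryMap_surjective 𝒜 z
    exact (mem_restrictedGraph.1 (h (mem_restrictedGraph.2 ⟨p.2, hz⟩))).2
  · intro h
    exact Submodule.map_mono (Submodule.comap_mono h)

lemma restrictedGraph_injective :
    Function.Injective (restrictedGraph (E := E) (I := I) 𝒜) := fun _ _ h =>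
  le_antisymm (restrictedGraph_le_iff.1 h.le) (restrictedGraph_le_iff.1 h.ge)

lemma restrictedGraph_top : restrictedGraph 𝒜 ⊤ = maximalGraph 𝒜 := by
  ext p
  simp [mem_restrictedGraph]

/-- Passing to the adjoint amounts to taking the symplectic complement of the boundary data. -/
lemma adjoint_restrictedGraph (M : Submodule ℂ ((Ends E I → ℂ) × (Ends E I → ℂ))) :
    (restrictedGraph 𝒜 M).adjoint = restrictedGraph 𝒜 (symplecticComplement M) := by
  ext x
  rw [mem_restrictedGraph]
  constructor
  · intro hx
    have h₀ : restrictedGraph 𝒜 ⊥ ≤ restrictedGraph 𝒜 M := restrictedGraph_le_iff.2 bot_le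
    have hmax : x ∈ maximalGraph 𝒜 := adjoint_restrictedGraph_bot_le (adjoint_anti h₀ hx)
    refine ⟨hmax, fun z hz => ?_⟩
    obtain ⟨p, rfl⟩ := boundaryMap_surjective 𝒜 z
    rw [← inner_sub_inner_eq p ⟨x, hmax⟩]
    exact (Submodule.mem_adjoint_iff _ _).1 hx _ _ (mem_restrictedGraph.2 ⟨p.2, hz⟩)
  · rintro ⟨hmax, hx⟩
    rw [Submodule.mem_adjoint_iff]
    intro b c hbc
    obtain ⟨hp, hM⟩ := mem_restrictedGraph.1 hbc
    rw [inner_sub_inner_eq ⟨(b, c), hp⟩ ⟨x, hmax⟩]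
    exact hx _ hM

/-- An operator with the boundary data `M` is densely defined: a vector `ψ` orthogonal to its domain
yields the element `(0, ψ)` of the adjoint, hence of the maximal graph. -/
lemma dense_domain_of_graph_eq {T : GraphL2 E a →ₗ.[ℂ] GraphL2 E a}
    {M : Submodule ℂ ((Ends E I → ℂ) × (Ends E I → ℂ))} (hT : T.graph = restrictedGraph 𝒜 M) :
    Dense (T.domain : Set (GraphL2 E a)) := by
  rw [Submodule.dense_iff_topologicalClosure_eq_top, Submodule.topologicalClosure_eq_top_iff,
    Submodule.eq_bot_iff]
  intro ψ hψ
  rw [Submodule.mem_orthogonal] at hψ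
  have hadj : ((0, ψ) : GraphL2 E a × GraphL2 E a) ∈ T.graph.adjoint := by
    rw [Submodule.mem_adjoint_iff]
    intro b c hbc
    rw [hψ b (LinearPMap.mem_domain_of_mem_graph hbc), inner_zero_right, sub_zero]
  rw [hT, adjoint_restrictedGraph, mem_restrictedGraph] at hadj
  exact maximalGraph_functional 𝒜 _ hadj.1 rfl

lemma isSelfAdjoint_iff_of_graph_eq {T : GraphL2 E a →ₗ.[ℂ] GraphL2 E a}
    {M : Submodule ℂ ((Ends E I → ℂ) × (Ends E I → ℂ))} (hT : T.graph = restrictedGraph 𝒜 M) :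
    IsSelfAdjoint T ↔ symplecticComplement M = M := by
  have hadj := LinearPMap.adjoint_graph_eq_graph_adjoint (dense_domain_of_graph_eq hT)
  rw [hT, adjoint_restrictedGraph] at hadj
  rw [LinearPMap.isSelfAdjoint_def]
  constructor
  · intro h
    rw [h, hT] at hadj
    exact restrictedGraph_injective hadj.symm
  · intro h
    rw [h, ← hT] at hadj
    exact LinearPMap.eq_of_eq_graph hadj

lemma graph_magneticLaplacian (A B : Matrix (Ends E I) (Ends E I) ℂ) :
    (magneticLaplacian 𝒜 A B).graph = restrictedGraph 𝒜 (boundaryKernel A B) := by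
  ext p
  rw [magneticLaplacian, mem_graph_domRestrict, maximalOperator_graph, mem_restrictedGraph]
  constructor
  · rintro ⟨h, hS⟩
    exact ⟨h, mem_boundaryKernel.2 ((mem_boundaryCondition_iff ⟨p, h⟩).1 hS)⟩
  · rintro ⟨h, hM⟩
    exact ⟨h, (mem_boundaryCondition_iff ⟨p, h⟩).2 (mem_boundaryKernel.1 hM)⟩

lemma graph_minimalOperator : (minimalOperator 𝒜).graph = restrictedGraph 𝒜 ⊥ := by
  ext p
  rw [minimalOperator, mem_graph_domRestrict, maximalOperator_graph, mem_restrictedGraph]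
  constructor
  · rintro ⟨h, hS⟩
    exact ⟨h, (Submodule.mem_bot ℂ).2 ((mem_vanishingBoundary_iff ⟨p, h⟩).1 hS)⟩
  · rintro ⟨h, hM⟩
    exact ⟨h, (mem_vanishingBoundary_iff ⟨p, h⟩).2 ((Submodule.mem_bot ℂ).1 hM)⟩

/-- An operator between the minimal and the maximal one is determined by its boundary data. -/
lemma exists_eq_restrictedGraph {g : Submodule ℂ (GraphL2 E a × GraphL2 E a)}
    (h₀ : restrictedGraph 𝒜 ⊥ ≤ g) (h₁ : g ≤ maximalGraph 𝒜) :
    ∃ M, g = restrictedGraph 𝒜 M := by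
  -- Elements of the maximal graph with the same boundary data differ by one of the minimal graph.
  refine ⟨(g.comap (maximalGraph 𝒜).subtype).map (boundaryMap 𝒜), ?_⟩
  ext p
  rw [mem_restrictedGraph]
  constructor
  · intro hp
    exact ⟨h₁ hp, ⟨p, h₁ hp⟩, hp, rfl⟩
  · rintro ⟨hp, q, hq, hpq⟩
    let r : maximalGraph 𝒜 := ⟨p, hp⟩ - q
    have hd : boundaryMap 𝒜 r = 0 := by rw [map_sub, hpq, sub_self]
    have hm : r.1 ∈ g := h₀ (mem_restrictedGraph.2 ⟨r.2, (Submodule.mem_bot ℂ).2 hd⟩)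
    have e : r.1 + q.1 = p := sub_add_cancel p q.1
    exact e ▸ g.add_mem hm hq

/-- A self-adjoint restriction of the maximal operator extends the minimal one, and conversely. -/
lemma IsSelfAdjointMagneticLaplacian.graph_mem {T : GraphL2 E a →ₗ.[ℂ] GraphL2 E a}
    (hT : IsSelfAdjointMagneticLaplacian 𝒜 T) :
    restrictedGraph 𝒜 ⊥ ≤ T.graph ∧ T.graph ≤ maximalGraph 𝒜 := by
  obtain ⟨hs, h⟩ := hT
  have hadj := LinearPMap.adjoint_graph_eq_graph_adjoint hs.dense_domain
  rw [LinearPMap.isSelfAdjoint_def.1 hs] at hadj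
  rcases h with h | h
  · have hle := LinearPMap.le_graph_of_le h
    rw [maximalOperator_graph] at hle
    refine ⟨?_, hle⟩
    rw [hadj]
    refine le_trans ?_ (adjoint_anti hle)
    rw [← restrictedGraph_top, adjoint_restrictedGraph]
    exact restrictedGraph_le_iff.2 bot_le
  · have hle := LinearPMap.le_graph_of_le h
    rw [graph_minimalOperator] at hle
    refine ⟨hle, ?_⟩
    rw [hadj]
    exact (adjoint_anti hle).trans adjoint_restrictedGraph_bot_le

end Extensions

end MagneticGraph

theorem theorem2p1 {E I : Type*} [Fintype E] [Fintype I] [DecidableEq E] [DecidableEq I]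
    (a : MagneticGraph.EdgeLengths I) (𝒜 : MagneticGraph.VectorPotential E a) :
    (∀ A B : Matrix (MagneticGraph.Ends E I) (MagneticGraph.Ends E I) ℂ,
      (A * Bᴴ - B * Aᴴ = 0 ∧
        (Matrix.fromCols A B).rank = Fintype.card E + 2 * Fintype.card I) ↔
      IsSelfAdjoint (MagneticGraph.magneticLaplacian 𝒜 A B)) ∧
    (∀ T : MagneticGraph.GraphL2 E a →ₗ.[ℂ] MagneticGraph.GraphL2 E a,
      MagneticGraph.IsSelfAdjointMagneticLaplacian 𝒜 T →
      ∃ A B : Matrix (MagneticGraph.Ends E I) (MagneticGraph.Ends E I) ℂ,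
        A * Bᴴ - B * Aᴴ = 0 ∧
        (Matrix.fromCols A B).rank = Fintype.card E + 2 * Fintype.card I ∧
        T = MagneticGraph.magneticLaplacian 𝒜 A B) := by
  have hcard : Fintype.card E + 2 * Fintype.card I = Fintype.card (MagneticGraph.Ends E I) := by
    rw [Fintype.card_sum, Fintype.card_sum, two_mul]
  rw [hcard]
  refine ⟨fun A B => ?_, fun T hT => ?_⟩
  · rw [MagneticGraph.isSelfAdjoint_iff_of_graph_eq (MagneticGraph.graph_magneticLaplacian A B),
      MagneticGraph.symplecticComplement_boundaryKernel_eq_self_iff]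
  · obtain ⟨M, hM⟩ := MagneticGraph.exists_eq_restrictedGraph hT.graph_mem.1 hT.graph_mem.2
    have hL := (MagneticGraph.isSelfAdjoint_iff_of_graph_eq hM).1 hT.1
    obtain ⟨A, B, rfl⟩ := MagneticGraph.exists_eq_boundaryKernel hL
    obtain ⟨h1, h2⟩ := MagneticGraph.symplecticComplement_boundaryKernel_eq_self_iff.1 hL
    refine ⟨A, B, h1, h2, LinearPMap.eq_of_eq_graph ?_⟩
    rw [hM, MagneticGraph.graph_magneticLaplacian]
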